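/- A \emph{graphing} is a quadruple $\mathbf G=(\Omega,\mathcal B,\mu,E)$, where $(\Omega,\mathcal B)$ is a standard Borel space, $E\subseteq\Omega\times\Omega$ is a symmetric Borel set without loops $(x,x)$, all of whose vertex degrees are bounded by a finite constant, and $\mu$ is a probability measure on $(\Omega,\mathcal B)$ such that $\int_A d_B(x)\,d\mu(x)=\int_B d_A(x)\,d\mu(x)$ for all $A,B\in\mathcal B$, where $d_B(x)$ is the number of neighbours of $x$ in $B$. We view $E$ as a set of unordered pairs, with the $\sigma$-algebra $\mathcal B_E$ of the symmetric Borel subsets of $E$. The (normalized) cycle-matroid rank function of $\mathbf G$ is $$\rho_{\mathbf G}(F)=\int_\Omega\Bigl(1-\frac1{|\mathbf G[F]_x|}\Bigr)d\mu(x),\qquad F\in\mathcal B_E,$$ where $|\mathbf G[F]_x|$ is the number of vertices of the connected component of $x$ in $(\Omega,F)$ and $1/\infty=0$. A finite graph $G=(V,E)$ is regarded as a graphing with all subsets of $V$ measurable and $\mu(S)=|S|/|V|$. For a real-valued function $\varphi$ on the measurable subsets of a measurable space $J$ and $k\ge1$, let $\mathcal Q_k(\varphi)\subseteq\mathbb R^{2^k}$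 be the set of all points $(\varphi(P^{-1}(A)))_{A\subseteq[k]}$, where $P\colon J\to[k]$ is measurable. A sequence $(\varphi_i)$ of such set functions, on possibly different measurable spaces, is \emph{quotient convergent} if for every $k\ge1$ the sets $\mathcal Q_k(\varphi_i)$ converge, as $i\to\infty$, to some subset of $\mathbb R^{2^k}$ in the Hausdorff distance (with respect to the Euclidean metric), and it \emph{quotient converges to} a set function $\varphi$ if for every $k\ge1$ the Hausdorff distance between $\mathcal Q_k(\varphi_i)$ and $\mathcal Q_k(\varphi)$ tends to $0$. \textbf{Theorem.} Let $D\ge1$ be an integer and let $(G_i)_{i\ge1}$ be a sequence of finite connected graphs with maximum degree at most $D$. Let $\rho_i$ be the rank function of the cycle matroid of $G_i$ as a graphing. If $(\rho_i)$ is quotient convergent, then there exists a graphing $\mathbf G$, with all degrees at most $D$, such that $(\rho_i)$ quotient converges to $\rho_{\mathbf G}$. -/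

import Mathlib

open MeasureTheory Filter Topology
open scoped ENNReal

/-- A graphing: a symmetric, loopless Borel edge set of bounded degree on a standard Borel space,
together with an involution invariant probability measure. -/
structure Graphing where
  /-- the vertex set -/
  Ω : Type*
  [measurableSpace : MeasurableSpace Ω]
  [standardBorel : StandardBorelSpace Ω]
  /-- the adjacency relation (symmetric and irreflexive) -/
  graph : SimpleGraph Ω
  measurableSet_adj : MeasurableSet {p : Ω × Ω | graph.Adj p.1 p.2}
  bounded_degree : ∃ D : ℕ, ∀ x, (graph.neighborSet x).encard ≤ D
  /-- the probability measure on the vertex set -/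
  μ : Measure Ω
  [isProbabilityMeasure : IsProbabilityMeasure μ]
  /-- involution invariance; `(graph.neighborSet x ∩ B).encard` is the degree of `x` in `B` -/
  involution_invariant : ∀ A B : Set Ω, MeasurableSet A → MeasurableSet B →
    ∫⁻ x in A, ((graph.neighborSet x ∩ B).encard : ℝ≥0∞) ∂μ =
      ∫⁻ x in B, ((graph.neighborSet x ∩ A).encard : ℝ≥0∞) ∂μ

attribute [instance] Graphing.measurableSpace Graphing.standardBorel Graphing.isProbabilityMeasure

namespace Graphing

/-- The set of (undirected) edges of a graphing. -/
abbrev Edge (G : Graphing) : Type _ := G.graph.edgeSet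

/-- The σ-algebra on the edge set: the unordered pairs are the quotient of `Ω × Ω` by swapping the
coordinates and carry the quotient σ-algebra, so that measurable sets of unordered pairs are exactly
the symmetric Borel subsets of `Ω × Ω`; the edge set carries the restriction of it. -/
instance (G : Graphing) : MeasurableSpace G.Edge :=
  MeasurableSpace.comap (Subtype.val : G.Edge → Sym2 G.Ω)
    (MeasurableSpace.map (fun p : G.Ω × G.Ω => s(p.1, p.2)) inferInstance)

/-- The vertex set of the connected component of `x` in the spanning subgraph with edge set `F`. -/
def component (G : Graphing) (F : Set G.Edge) (x : G.Ω) : Set G.Ω :=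
  {y | (SimpleGraph.fromEdgeSet (Subtype.val '' F)).Reachable x y}

/-- The (normalized) rank function of the cycle matroid of a graphing,
`ρ(F) = ∫ (1 - 1 / |G[F]_x|) dμ(x)`; it is meant for measurable `F` only.
An infinite component contributes `1 / ∞ = 0`: its `Set.ncard` is `0` and `(0 : ℝ)⁻¹ = 0`,
and a component is never empty since it contains `x`. -/
noncomputable def rank (G : Graphing) (F : Set G.Edge) : ℝ :=
  ∫ x, (1 - ((G.component F x).ncard : ℝ)⁻¹) ∂G.μ

end Graphing

theorem SimpleGraph.setLIntegral_degree_uniform {V : Type*} [Fintype V] [MeasurableSpace V]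
    [DiscreteMeasurableSpace V] (G : SimpleGraph V) (c : ℝ≥0∞) (A B : Set V) :
    ∫⁻ x in A, ((G.neighborSet x ∩ B).encard : ℝ≥0∞) ∂(c • (Measure.count : Measure V)) =
      ∫⁻ x in B, ((G.neighborSet x ∩ A).encard : ℝ≥0∞) ∂(c • (Measure.count : Measure V)) := by
  classical
  have key : ∀ A B : Set V, ∫⁻ x in A, ((G.neighborSet x ∩ B).encard : ℝ≥0∞)
      ∂(c • (Measure.count : Measure V)) =
      c * ∑ x, ∑ y, if x ∈ A ∧ y ∈ B ∧ G.Adj x y then 1 else 0 := by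
    intro A B
    rw [← lintegral_indicator (MeasurableSet.of_discrete), lintegral_smul_measure,
      lintegral_count, tsum_fintype, smul_eq_mul]
    congr 1
    refine Finset.sum_congr rfl fun x _ => ?_
    by_cases hx : x ∈ A
    · have : G.neighborSet x ∩ B = ((Finset.univ.filter fun y => y ∈ B ∧ G.Adj x y : Finset V)) := by
        ext y; simp [and_comm]
      rw [Set.indicator_of_mem hx, this, Set.encard_coe_eq_coe_finsetCard]
      simp [hx]
    · simp [hx]
  rw [key, key, Finset.sum_comm]
  congr 1
  refine Finset.sum_congr rfl fun x _ => Finset.sum_congr rfl fun y _ => ?_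
  simp only [G.adj_comm x y]
  congr 1
  exact propext (by tauto)

/-- A finite graph as a graphing: all vertex sets are Borel and the measure is the uniform one,
`μ(S) = |S| / |V|`. -/
noncomputable def SimpleGraph.toGraphing {V : Type*} [Fintype V] [Nonempty V] (G : SimpleGraph V) :
    Graphing :=
  letI : MeasurableSpace V := ⊤
  haveI : DiscreteMeasurableSpace V := ⟨fun _ => trivial⟩
  { Ω := V
    graph := G
    measurableSet_adj := MeasurableSet.of_discrete
    bounded_degree := ⟨Fintype.card V, fun x => by
      refine (Set.encard_le_encard (Set.subset_univ _)).trans ?_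
      simp [Set.encard_univ]⟩
    μ := (Fintype.card V : ℝ≥0∞)⁻¹ • Measure.count
    isProbabilityMeasure := ⟨by
      simp [Measure.count_apply, Set.encard_univ, ENNReal.inv_mul_cancel]⟩
    involution_invariant := fun A B _ _ => G.setLIntegral_degree_uniform _ A B }

/-- The set `𝒬_k(φ)` of `k`-quotients `φ ∘ P⁻¹`, with `P : J → [k]` measurable, of a set function `φ`
on the measurable subsets of `J`, as a set of points of `ℝ ^ (2 ^ k)` with the Euclidean metric.
Only the values of `φ` on measurable sets enter. -/
def quotientSet {J : Type*} [MeasurableSpace J] (k : ℕ) (φ : Set J → ℝ) :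
    Set (EuclideanSpace ℝ (Finset (Fin k))) :=
  {v | ∃ P : J → Fin k, Measurable P ∧ ∀ A : Finset (Fin k), v A = φ (P ⁻¹' (A : Set (Fin k)))}

/-- `φ_i` quotient converges to `ψ`: for each `k ≥ 1` the sets of `k`-quotients converge in the
Hausdorff distance. -/
def QuotientConvergesTo {J : ℕ → Type*} [∀ i, MeasurableSpace (J i)] {J' : Type*}
    [MeasurableSpace J'] (φ : ∀ i, Set (J i) → ℝ) (ψ : Set J' → ℝ) : Prop :=
  ∀ k : ℕ, 1 ≤ k →
    Tendsto (fun i => Metric.hausdorffEDist (quotientSet k (φ i)) (quotientSet k ψ)) atTop (𝓝 0)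

/-- `φ_i` is quotient convergent: for each `k ≥ 1` the sets of `k`-quotients converge in the
Hausdorff distance to some set, which is not required to come from a set function. -/
def QuotientConvergent {J : ℕ → Type*} [∀ i, MeasurableSpace (J i)]
    (φ : ∀ i, Set (J i) → ℝ) : Prop :=
  ∀ k : ℕ, 1 ≤ k → ∃ A : Set (EuclideanSpace ℝ (Finset (Fin k))),
    Tendsto (fun i => Metric.hausdorffEDist (quotientSet k (φ i)) A) atTop (𝓝 0)

/-!
Splitting the edges into `2D + 1` matchings turns a graphing into a measure preserving action of
finitely many involutions, and its `k`-quotients into the ranks of edge colourings. Since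
`1 / |C|` differs by at most `1 / (r + 1)` from its counterpart for the ball of radius `r` inside
the cluster `C`, the rank is a uniform limit of functionals that see only a bounded neighbourhood.

Label the vertices of all the `Γ i` by a point of a product of finite sets that separates the points
reached by different words and also records, for each `k`, edge colourings whose quotient vectors
converge to a dense sequence in the limit of the sets `𝒬_k`. The closure of the set of itineraries
is a compact, totally disconnected space with involutions whose local structure is locally constant,
and the limit graphing is this space with a weak limit of the images of the measures. Ranks of
continuous colourings converge, and measurable colourings are approximated by continuous ones, so
every quotient of the limit graphing lies in the closed limit of the sets `𝒬_k`; the recorded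
colourings extend continuously and provide the reverse inclusion.
-/

universe u v

section Words

variable {ι Ω Ω' : Type*}

/-- The action of a word in the generators `s`; the first letter acts first. -/
def wordAct (s : ι → Ω → Ω) (w : List ι) (x : Ω) : Ω :=
  w.foldl (fun y j => s j y) x

/-- The walk from `x` along a word uses allowed steps only, `x ∈ O j` meaning that the step
`x ↦ s j x` is allowed. -/
def Admissible (s : ι → Ω → Ω) (O : ι → Set Ω) : List ι → Ω → Prop
  | [], _ => True
  | j :: w, x => x ∈ O j ∧ Admissible s O w (s j x)

/-- The points reached from `x` by admissible walks: the component of `x` in percolation with open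
steps `O`. -/
def cluster (s : ι → Ω → Ω) (O : ι → Set Ω) (x : Ω) : Set Ω :=
  {y | ∃ w, Admissible s O w x ∧ wordAct s w x = y}

/-- The points reached from `x` by admissible walks of length at most `r`. -/
def clusterBall (s : ι → Ω → Ω) (O : ι → Set Ω) (r : ℕ) (x : Ω) : Set Ω :=
  {y | ∃ w : List ι, w.length ≤ r ∧ Admissible s O w x ∧ wordAct s w x = y}

/-- An equivariant map that is injective on every orbit. -/
structure IsFaithfulHom (s : ι → Ω → Ω) (s' : ι → Ω' → Ω') (f : Ω → Ω') : Prop where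
  map_apply (j : ι) (x : Ω) : f (s j x) = s' j (f x)
  injOn_orbit (x : Ω) : Set.InjOn f (Set.range fun w => wordAct s w x)

variable {s : ι → Ω → Ω} {O : ι → Set Ω}

theorem wordAct_append (w w' : List ι) (x : Ω) :
    wordAct s (w ++ w') x = wordAct s w' (wordAct s w x) :=
  List.foldl_append

theorem injective_wordAct (hs : ∀ j, Function.Injective (s j)) (w : List ι) :
    Function.Injective (wordAct s w) := by
  induction w with
  | nil => exact Function.injective_id
  | cons j w ih => exact ih.comp (hs j)

theorem map_wordAct {s' : ι → Ω' → Ω'} {f : Ω → Ω'} (hf : ∀ j x, f (s j x) = s' j (f x))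
    (w : List ι) (x : Ω) : f (wordAct s w x) = wordAct s' w (f x) :=
  (List.foldl_hom f fun _ _ => (hf _ _).symm).symm

theorem admissible_append (w w' : List ι) (x : Ω) :
    Admissible s O (w ++ w') x ↔ Admissible s O w x ∧ Admissible s O w' (wordAct s w x) := by
  induction w generalizing x with
  | nil => simp [Admissible, wordAct]
  | cons j w ih => exact (and_congr_right fun _ => ih (s j x)).trans and_assoc.symm

theorem admissible_map {s' : ι → Ω' → Ω'} {f : Ω → Ω'} (hf : ∀ j x, f (s j x) = s' j (f x))
    (O : ι → Set Ω') (w : List ι) (x : Ω) :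
    Admissible s' O w (f x) ↔ Admissible s (fun j => f ⁻¹' O j) w x := by
  induction w generalizing x with
  | nil => rfl
  | cons j w ih => exact and_congr_right fun _ => hf j x ▸ ih (s j x)

theorem cluster_map {s' : ι → Ω' → Ω'} {f : Ω → Ω'} (hf : ∀ j x, f (s j x) = s' j (f x))
    (O : ι → Set Ω') (x : Ω) :
    cluster s' O (f x) = f '' cluster s (fun j => f ⁻¹' O j) x := by
  ext y
  simp only [cluster, Set.mem_image, Set.mem_ofPred_eq, admissible_map hf, ← map_wordAct hf,
    exists_exists_and_eq_and]

theorem IsFaithfulHom.ncard_cluster {s' : ι → Ω' → Ω'} {f : Ω → Ω'} (hf : IsFaithfulHom s s' f)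
    (O : ι → Set Ω') (x : Ω) :
    (cluster s' O (f x)).ncard = (cluster s (fun j => f ⁻¹' O j) x).ncard := by
  have hsub : cluster s (fun j => f ⁻¹' O j) x ⊆ Set.range fun w => wordAct s w x :=
    fun _ ⟨w, hw⟩ => ⟨w, hw.2⟩
  rw [cluster_map hf.map_apply, ((hf.injOn_orbit x).mono hsub).ncard_image]

theorem clusterBall_subset_cluster (r : ℕ) (x : Ω) : clusterBall s O r x ⊆ cluster s O x :=
  fun _ ⟨w, _, h⟩ => ⟨w, h⟩

theorem self_mem_clusterBall (r : ℕ) (x : Ω) : x ∈ clusterBall s O r x :=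
  ⟨[], Nat.zero_le r, trivial, rfl⟩

theorem clusterBall_mono {r r' : ℕ} (h : r ≤ r') (x : Ω) :
    clusterBall s O r x ⊆ clusterBall s O r' x :=
  fun _ ⟨w, hw, hy⟩ => ⟨w, hw.trans h, hy⟩

theorem apply_mem_clusterBall_succ {r : ℕ} {x y : Ω} {j : ι} (hy : y ∈ clusterBall s O r x)
    (hj : y ∈ O j) : s j y ∈ clusterBall s O (r + 1) x := by
  obtain ⟨w, hw, hadm, rfl⟩ := hy
  exact ⟨w ++ [j], by simpa using hw, (admissible_append _ _ _).2 ⟨hadm, hj, trivial⟩,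
    wordAct_append _ _ _⟩

theorem apply_mem_cluster {x y : Ω} {j : ι} (hy : y ∈ cluster s O x) (hj : y ∈ O j) :
    s j y ∈ cluster s O x := by
  obtain ⟨w, hw⟩ := hy
  exact clusterBall_subset_cluster _ x (apply_mem_clusterBall_succ ⟨w, le_rfl, hw⟩ hj)

theorem cluster_subset_of_closed {S : Set Ω} {x : Ω} (hx : x ∈ S)
    (hS : ∀ y ∈ S, ∀ j, y ∈ O j → s j y ∈ S) : cluster s O x ⊆ S := by
  rintro _ ⟨w, hw, rfl⟩
  induction w generalizing x with
  | nil => exact hx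
  | cons j w ih => exact ih (hS x hx j hw.1) hw.2

theorem cluster_eq_clusterBall {r : ℕ} {x : Ω}
    (h : clusterBall s O (r + 1) x = clusterBall s O r x) :
    cluster s O x = clusterBall s O r x :=
  (cluster_subset_of_closed (self_mem_clusterBall r x) fun _ hy _ hj =>
    h ▸ apply_mem_clusterBall_succ hy hj).antisymm (clusterBall_subset_cluster r x)

theorem clusterBall_eq_image (r : ℕ) (x : Ω) :
    clusterBall s O r x =
      (fun w => wordAct s w x) '' {w : List ι | w.length ≤ r ∧ Admissible s O w x} := by
  ext y
  simp only [clusterBall, Set.mem_image, Set.mem_ofPred_eq, and_assoc]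

theorem ncard_clusterBall_congr {O' : ι → Set Ω} {r : ℕ} {x x' : Ω}
    (hadm : ∀ w : List ι, w.length ≤ r → (Admissible s O w x ↔ Admissible s O' w x'))
    (heq : ∀ w w' : List ι, w.length ≤ r → w'.length ≤ r →
      (wordAct s w x = wordAct s w' x ↔ wordAct s w x' = wordAct s w' x')) :
    (clusterBall s O r x).ncard = (clusterBall s O' r x').ncard := by
  choose! g hg using fun y (hy : y ∈ clusterBall s O r x) => hy
  refine Set.ncard_congr (fun y _ => wordAct s (g y) x') ?_ ?_ ?_
  · intro y hy
    exact ⟨g y, (hg y hy).1, (hadm _ (hg y hy).1).1 (hg y hy).2.1, rfl⟩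
  · intro y z hy hz h
    rw [← (hg y hy).2.2, ← (hg z hz).2.2]
    exact (heq _ _ (hg y hy).1 (hg z hz).1).2 h
  · rintro _ ⟨w, hw, hw', rfl⟩
    have hmem : wordAct s w x ∈ clusterBall s O r x := ⟨w, hw, (hadm w hw).2 hw', rfl⟩
    exact ⟨_, hmem, (heq _ _ (hg _ hmem).1 hw).1 (hg _ hmem).2.2⟩

theorem admissible_congr {O' : ι → Set Ω} {r : ℕ} {x : Ω}
    (h : ∀ w : List ι, w.length ≤ r → ∀ j, wordAct s w x ∈ O j ↔ wordAct s w x ∈ O' j)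
    {w : List ι} (hw : w.length ≤ r) : Admissible s O w x ↔ Admissible s O' w x := by
  induction w generalizing x r with
  | nil => rfl
  | cons j w ih =>
    cases r with
    | zero => simp at hw
    | succ r =>
      exact and_congr (h [] (Nat.zero_le _) j)
        (ih (fun v hv => h (j :: v) (Nat.succ_le_succ hv)) (Nat.le_of_succ_le_succ hw))

theorem ncard_clusterBall_eq_of_notMem_symmDiff {O' : ι → Set Ω} {r : ℕ} {x : Ω}
    (h : ∀ w : List ι, w.length ≤ r → ∀ j, wordAct s w x ∉ symmDiff (O j) (O' j)) :
    (clusterBall s O r x).ncard = (clusterBall s O' r x).ncard := by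
  refine ncard_clusterBall_congr (fun w => admissible_congr fun v hv j => ?_)
    fun _ _ _ _ => Iff.rfl
  have := h v hv j
  rw [Set.mem_symmDiff] at this
  tauto

variable [Finite ι]

theorem finite_clusterBall (r : ℕ) (x : Ω) : (clusterBall s O r x).Finite := by
  rw [clusterBall_eq_image]
  exact ((List.finite_length_le ι r).subset fun w hw => hw.1).image _

theorem ncard_clusterBall_pos (r : ℕ) (x : Ω) : 0 < (clusterBall s O r x).ncard :=
  (Set.ncard_pos (finite_clusterBall r x)).2 ⟨x, self_mem_clusterBall r x⟩

theorem lt_ncard_clusterBall {r : ℕ} {x : Ω} (h : cluster s O x ≠ clusterBall s O r x) :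
    r < (clusterBall s O r x).ncard := by
  suffices ∀ m ≤ r, m < (clusterBall s O m x).ncard from this r le_rfl
  intro m
  induction m with
  | zero => exact fun _ => ncard_clusterBall_pos 0 x
  | succ m ih =>
    intro hm
    have hne : clusterBall s O m x ≠ clusterBall s O (m + 1) x := by
      intro heq
      have hstable := cluster_eq_clusterBall heq.symm
      exact h ((hstable.trans_subset (clusterBall_mono (Nat.le_of_succ_le hm) x)).antisymm
        (clusterBall_subset_cluster r x))
    exact (Nat.succ_le_of_lt (ih (Nat.le_of_succ_le hm))).trans_lt
      (Set.ncard_lt_ncard ((clusterBall_mono m.le_succ x).ssubset_of_ne hne)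
        (finite_clusterBall _ x))

theorem abs_inv_ncard_clusterBall_sub_le (r : ℕ) (x : Ω) :
    |((clusterBall s O r x).ncard : ℝ)⁻¹ - ((cluster s O x).ncard : ℝ)⁻¹| ≤ ((r : ℝ) + 1)⁻¹ := by
  by_cases h : cluster s O x = clusterBall s O r x
  · rw [h, sub_self, abs_zero]
    positivity
  have hball : ((clusterBall s O r x).ncard : ℝ)⁻¹ ≤ ((r : ℝ) + 1)⁻¹ := by
    gcongr
    exact_mod_cast lt_ncard_clusterBall h
  have hcluster : ((cluster s O x).ncard : ℝ)⁻¹ ≤ ((clusterBall s O r x).ncard : ℝ)⁻¹ := by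
    by_cases hfin : (cluster s O x).Finite
    · exact inv_anti₀ (mod_cast ncard_clusterBall_pos r x)
        (mod_cast Set.ncard_le_ncard (clusterBall_subset_cluster r x) hfin)
    · rw [Set.Infinite.ncard hfin, Nat.cast_zero, inv_zero]
      positivity
  rw [abs_of_nonneg (sub_nonneg.2 hcluster)]
  exact (sub_le_self _ (by positivity)).trans hball

end Words

section Coloring

variable {V : Type*}

theorem colorable_of_encard_neighborSet_le (G : SimpleGraph V) {d : ℕ}
    (hd : ∀ v, (G.neighborSet v).encard ≤ d) : G.Colorable (d + 1) := by
  classical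
  have exists_unused (v : V) (f : V → Fin (d + 1)) : ∃ t, t ∉ f '' G.neighborSet v := by
    by_contra! h
    have hcard : (Set.univ : Set (Fin (d + 1))).encard ≤ d :=
      (Set.encard_le_encard fun t _ => h t).trans ((Set.encard_image_le _ _).trans (hd v))
    rw [Set.encard_univ, ENat.card_eq_coe_fintype_card, Fintype.card_fin] at hcard
    exact absurd (Nat.cast_le.1 hcard) (Nat.not_succ_le_self d)
  choose unused h_unused using exists_unused
  -- The greedy colouring along a well-ordering of the vertices.
  let c : V → Fin (d + 1) := IsWellFounded.fix WellOrderingRel fun v earlier =>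
    unused v fun w => if h : WellOrderingRel w v then earlier w h else 0
  have hc : ∀ v w, G.Adj v w → WellOrderingRel w v → c v ≠ c w := by
    intro v w hvw hlt heq
    refine h_unused v (fun u => if WellOrderingRel u v then c u else 0) ⟨w, hvw, ?_⟩
    exact (if_pos hlt).trans (heq.symm.trans (IsWellFounded.fix_eq _ _ _))
  refine ⟨SimpleGraph.Coloring.mk c fun {v w} hvw => ?_⟩
  rcases trichotomous_of WellOrderingRel v w with hlt | rfl | hlt
  · exact (hc w v hvw.symm hlt).symm
  · exact absurd hvw (G.loopless.irrefl v)
  · exact hc v w hvw hlt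

theorem exists_fin_three_coloring_separating {W : Type*} {p q : W → V}
    (hp : Function.Injective p) (hq : Function.Injective q) :
    ∃ c : V → Fin 3, ∀ v, c (p v) = c (q v) → p v = q v := by
  let G := SimpleGraph.fromRel fun x y => ∃ v, p v = x ∧ q v = y
  have hG (x : V) : (G.neighborSet x).encard ≤ (2 : ℕ) := by
    have hsub : G.neighborSet x ⊆ q '' (p ⁻¹' {x}) ∪ p '' (q ⁻¹' {x}) := by
      rintro y ⟨_, ⟨v, hx, hy⟩ | ⟨v, hy, hx⟩⟩
      · exact Or.inl ⟨v, hx, hy⟩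
      · exact Or.inr ⟨v, hx, hy⟩
    refine (Set.encard_le_encard hsub).trans ((Set.encard_union_le _ _).trans ?_)
    rw [Nat.cast_two, ← one_add_one_eq_two]
    exact add_le_add
      (Set.encard_le_one_iff_subsingleton.2 ((Set.subsingleton_singleton.preimage hp).image q))
      (Set.encard_le_one_iff_subsingleton.2 ((Set.subsingleton_singleton.preimage hq).image p))
  obtain ⟨c⟩ := colorable_of_encard_neighborSet_le G hG
  refine ⟨c, fun v => not_imp_not.1 fun hne => c.valid ?_⟩
  exact ⟨hne, Or.inl ⟨v, rfl, rfl⟩⟩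

theorem encard_incidenceSet_le (G : SimpleGraph V) (v : V) :
    (G.incidenceSet v).encard ≤ (G.neighborSet v).encard := by
  have hsub : G.incidenceSet v ⊆ (fun w => s(v, w)) '' G.neighborSet v := by
    rintro _ ⟨he, w, rfl⟩
    exact ⟨w, he, rfl⟩
  exact (Set.encard_le_encard hsub).trans (Set.encard_image_le _ _)

theorem lineGraph_colorable (G : SimpleGraph V) {D : ℕ}
    (hD : ∀ v, (G.neighborSet v).encard ≤ D) : G.lineGraph.Colorable (2 * D + 1) := by
  refine colorable_of_encard_neighborSet_le _ fun e => ?_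
  obtain ⟨⟨x, y⟩, he⟩ := e
  have hsub : Subtype.val '' G.lineGraph.neighborSet ⟨s(x, y), he⟩ ⊆
      G.incidenceSet x ∪ G.incidenceSet y := by
    rintro _ ⟨e', hadj, rfl⟩
    obtain ⟨_, v, hv, hv'⟩ := SimpleGraph.lineGraph_adj_iff_exists.1 hadj
    rcases Sym2.mem_iff.1 hv with rfl | rfl
    · exact Or.inl ⟨e'.2, hv'⟩
    · exact Or.inr ⟨e'.2, hv'⟩
  rw [← Subtype.val_injective.encard_image, two_mul, Nat.cast_add]
  exact (Set.encard_le_encard hsub).trans ((Set.encard_union_le _ _).trans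
    (add_le_add ((encard_incidenceSet_le G x).trans (hD x))
      ((encard_incidenceSet_le G y).trans (hD y))))

end Coloring

section MatchingFamily

variable {ι Ω : Type*}

/-- The involution `s j` exchanges the endpoints of the `j`-th of a family of disjoint matchings,
and fixes the points that this matching does not cover. -/
structure IsMatchingFamily (s : ι → Ω → Ω) : Prop where
  involutive (j : ι) : Function.Involutive (s j)
  eq_of_apply_eq {j k : ι} {x : Ω} : s j x = s k x → s j x ≠ x → j = k

/-- The union of the matchings of a matching family. -/
def matchingGraph (s : ι → Ω → Ω) : SimpleGraph Ω :=
  SimpleGraph.fromRel fun x y => ∃ j, s j x = y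

variable {s : ι → Ω → Ω}

theorem IsMatchingFamily.matchingGraph_adj (hs : IsMatchingFamily s) {x y : Ω} :
    (matchingGraph s).Adj x y ↔ x ≠ y ∧ ∃ j, s j x = y := by
  refine and_congr_right fun _ => or_iff_left_of_imp ?_
  rintro ⟨j, rfl⟩
  exact ⟨j, hs.involutive j y⟩

theorem IsMatchingFamily.encard_neighborSet_inter (hs : IsMatchingFamily s) (x : Ω) (B : Set Ω) :
    ((matchingGraph s).neighborSet x ∩ B).encard = {j | s j x ≠ x ∧ s j x ∈ B}.encard := by
  have himage : (matchingGraph s).neighborSet x ∩ B =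
      (fun j => s j x) '' {j | s j x ≠ x ∧ s j x ∈ B} := by
    ext y
    simp only [Set.mem_inter_iff, SimpleGraph.mem_neighborSet, hs.matchingGraph_adj]
    constructor
    · rintro ⟨⟨hne, j, rfl⟩, hB⟩
      exact ⟨j, ⟨hne.symm, hB⟩, rfl⟩
    · rintro ⟨j, ⟨hne, hB⟩, rfl⟩
      exact ⟨⟨hne.symm, j, rfl⟩, hB⟩
  rw [himage]
  exact Set.InjOn.encard_image fun j hj k _ h => hs.eq_of_apply_eq h hj.1

theorem IsMatchingFamily.encard_neighborSet (hs : IsMatchingFamily s) (x : Ω) :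
    ((matchingGraph s).neighborSet x).encard = {j | s j x ≠ x}.encard := by
  simpa using hs.encard_neighborSet_inter x Set.univ

theorem exists_involutive_of_partial_matching {M : Ω → Ω → Prop} (M_symm : ∀ x y, M x y → M y x)
    (M_unique : ∀ x y z, M x y → M x z → y = z) :
    ∃ f : Ω → Ω, Function.Involutive f ∧ (∀ x y, M x y → f x = y) ∧
      ∀ x, f x ≠ x → M x (f x) := by
  classical
  let f (x : Ω) : Ω := if h : ∃ y, M x y then h.choose else x
  have f_eq (x y : Ω) (h : M x y) : f x = y := by
    have hex : ∃ y, M x y := ⟨y, h⟩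
    rw [show f x = hex.choose from dif_pos hex]
    exact M_unique _ _ _ hex.choose_spec h
  have M_apply (x : Ω) (h : f x ≠ x) : M x (f x) := by
    by_cases hex : ∃ y, M x y
    · exact (f_eq _ _ hex.choose_spec).symm ▸ hex.choose_spec
    · exact absurd (dif_neg hex) h
  refine ⟨f, fun x => ?_, f_eq, M_apply⟩
  by_cases h : f x = x
  · rw [h, h]
  · exact f_eq _ _ (M_symm _ _ (M_apply x h))

theorem exists_isMatchingFamily (G : SimpleGraph Ω) {D : ℕ}
    (hD : ∀ x, (G.neighborSet x).encard ≤ D) :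
    ∃ s : Fin (2 * D + 1) → Ω → Ω, IsMatchingFamily s ∧ G = matchingGraph s := by
  obtain ⟨c⟩ := lineGraph_colorable G hD
  let M (j : Fin (2 * D + 1)) (x y : Ω) : Prop := ∃ h : s(x, y) ∈ G.edgeSet, c ⟨s(x, y), h⟩ = j
  have M_symm (j) (x y : Ω) (h : M j x y) : M j y x := by
    have hswap : s(x, y) = s(y, x) := Sym2.eq_swap
    simpa only [M, hswap] using h
  have M_unique (j) (x y z : Ω) (hy : M j x y) (hz : M j x z) : y = z := by
    by_contra hne
    refine c.valid (SimpleGraph.lineGraph_adj_iff_exists.2 ⟨fun h => hne ?_, x, ?_, ?_⟩)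
      (hy.2.trans hz.2.symm)
    · exact Sym2.congr_right.1 (congrArg Subtype.val h)
    · exact Sym2.mem_mk_left x y
    · exact Sym2.mem_mk_left x z
  choose s s_involutive s_eq M_apply using fun j =>
    exists_involutive_of_partial_matching (M_symm j) (M_unique j)
  have hs : IsMatchingFamily s := by
    refine ⟨s_involutive, fun {j k x} h hne => ?_⟩
    obtain ⟨_, hj⟩ := M_apply j x hne
    obtain ⟨_, hk⟩ : M k x (s j x) := h ▸ M_apply k x (h ▸ hne)
    exact hj.symm.trans hk
  refine ⟨s, hs, SimpleGraph.ext (funext₂ fun x y => propext ?_)⟩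
  rw [hs.matchingGraph_adj]
  constructor
  · exact fun h => ⟨h.ne, _, s_eq _ _ _ ⟨h, rfl⟩⟩
  · rintro ⟨hne, j, rfl⟩
    exact (M_apply j x hne.symm).1

end MatchingFamily

section ClusterRank

variable {ι Ω : Type*} [MeasurableSpace Ω]

/-- The rank `∫ (1 - 1 / |cluster|)` of a system of open steps, where `1 / ∞ = 0` by the junk
values of `Set.ncard` and of the inverse. -/
noncomputable def clusterRank (s : ι → Ω → Ω) (O : ι → Set Ω) (μ : Measure Ω) : ℝ :=
  ∫ x, (1 - ((cluster s O x).ncard : ℝ)⁻¹) ∂μ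

/-- The truncation of `clusterRank` to walks of length at most `r`. -/
noncomputable def ballRank (s : ι → Ω → Ω) (O : ι → Set Ω) (r : ℕ) (μ : Measure Ω) : ℝ :=
  ∫ x, (1 - ((clusterBall s O r x).ncard : ℝ)⁻¹) ∂μ

variable {s : ι → Ω → Ω} {O O' : ι → Set Ω} {μ : Measure Ω}

theorem measurable_wordAct (hs : ∀ j, Measurable (s j)) (w : List ι) :
    Measurable (wordAct s w) := by
  induction w with
  | nil => exact measurable_id
  | cons j w ih => exact ih.comp (hs j)

theorem measurePreserving_wordAct (hs : ∀ j, MeasurePreserving (s j) μ μ) (w : List ι) :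
    MeasurePreserving (wordAct s w) μ μ := by
  induction w with
  | nil => exact MeasurePreserving.id μ
  | cons j w ih => exact ih.comp (hs j)

theorem measurableSet_admissible (hs : ∀ j, Measurable (s j)) (hO : ∀ j, MeasurableSet (O j))
    (w : List ι) : MeasurableSet {x | Admissible s O w x} := by
  induction w with
  | nil => exact MeasurableSet.univ
  | cons j w ih => exact (hO j).inter (hs j ih)

theorem abs_inv_natCast_sub_inv_natCast_le (m n : ℕ) : |(m : ℝ)⁻¹ - (n : ℝ)⁻¹| ≤ 1 :=
  abs_sub_le_of_nonneg_of_le (by positivity) (Nat.cast_inv_le_one m) (by positivity)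
    (Nat.cast_inv_le_one n)

theorem integrable_one_sub_inv [IsFiniteMeasure μ] {f : Ω → ℕ}
    (hf : Measurable fun x => (f x : ℝ)⁻¹) : Integrable (fun x => 1 - (f x : ℝ)⁻¹) μ := by
  refine Integrable.of_bound (measurable_const.sub hf).aestronglyMeasurable 1 (ae_of_all _ ?_)
  intro x
  simpa using abs_inv_natCast_sub_inv_natCast_le 1 (f x)

variable [Finite ι] [MeasurableEq Ω]

theorem measurable_ncard_clusterBall (hs : ∀ j, Measurable (s j)) (hO : ∀ j, MeasurableSet (O j))
    (r : ℕ) : Measurable fun x => (clusterBall s O r x).ncard := by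
  let W := {w : List ι // w.length ≤ r}
  have : Finite W := List.finite_length_le ι r
  let profile (x : Ω) : (W → Prop) × (W → W → Prop) :=
    (fun w => Admissible s O w x, fun w w' => wordAct s w x = wordAct s w' x)
  have h_profile : Measurable profile := by
    refine Measurable.prodMk (measurable_pi_lambda _ fun w => ?_)
      (measurable_pi_lambda _ fun w => measurable_pi_lambda _ fun w' => ?_)
    · exact measurableSet_setOfPred.1 (measurableSet_admissible hs hO w)
    · exact measurableSet_setOfPred.1
        (measurableSet_eq_fun (measurable_wordAct hs w) (measurable_wordAct hs w'))
  have h_factors : (fun x => (clusterBall s O r x).ncard).FactorsThrough profile := by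
    intro x y hxy
    obtain ⟨hadm, heq⟩ := Prod.ext_iff.1 hxy
    exact ncard_clusterBall_congr (fun w hw => iff_of_eq (congrFun hadm ⟨w, hw⟩))
      fun w w' hw hw' => iff_of_eq (congrFun₂ heq ⟨w, hw⟩ ⟨w', hw'⟩)
  rw [← h_factors.extend_comp (fun _ => 0)]
  exact (measurable_of_finite _).comp h_profile

theorem measurable_inv_ncard_clusterBall (hs : ∀ j, Measurable (s j))
    (hO : ∀ j, MeasurableSet (O j)) (r : ℕ) :
    Measurable fun x => ((clusterBall s O r x).ncard : ℝ)⁻¹ :=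
  (measurable_from_top (f := fun n : ℕ => (n : ℝ)⁻¹)).comp (measurable_ncard_clusterBall hs hO r)

theorem measurable_inv_ncard_cluster (hs : ∀ j, Measurable (s j))
    (hO : ∀ j, MeasurableSet (O j)) : Measurable fun x => ((cluster s O x).ncard : ℝ)⁻¹ := by
  refine measurable_of_tendsto_metrizable (measurable_inv_ncard_clusterBall hs hO)
    (tendsto_pi_nhds.2 fun x => tendsto_iff_dist_tendsto_zero.2 ?_)
  refine squeeze_zero (fun _ => dist_nonneg) (fun r => abs_inv_ncard_clusterBall_sub_le r x) ?_
  simpa using tendsto_one_div_add_atTop_nhds_zero_nat (𝕜 := ℝ)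

theorem abs_ballRank_sub_clusterRank_le [IsProbabilityMeasure μ] (hs : ∀ j, Measurable (s j))
    (hO : ∀ j, MeasurableSet (O j)) (r : ℕ) :
    |ballRank s O r μ - clusterRank s O μ| ≤ ((r : ℝ) + 1)⁻¹ := by
  rw [clusterRank, ballRank, ← integral_sub
    (integrable_one_sub_inv (measurable_inv_ncard_clusterBall hs hO r))
    (integrable_one_sub_inv (measurable_inv_ncard_cluster hs hO)), ← Real.norm_eq_abs]
  refine (norm_integral_le_of_norm_le_const (C := ((r : ℝ) + 1)⁻¹) (ae_of_all μ fun x => ?_)).trans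
    (by simp)
  rw [Real.norm_eq_abs, sub_sub_sub_cancel_left, abs_sub_comm]
  exact abs_inv_ncard_clusterBall_sub_le r x

theorem tendsto_clusterRank_of_tendsto_ballRank {α : Type*} {l : Filter α} {O' : α → ι → Set Ω}
    {ν : α → Measure Ω} [∀ a, IsProbabilityMeasure (ν a)] [IsProbabilityMeasure μ]
    (hs : ∀ j, Measurable (s j)) (hO' : ∀ a j, MeasurableSet (O' a j))
    (hO : ∀ j, MeasurableSet (O j))
    (h : ∀ r, Tendsto (fun a => ballRank s (O' a) r (ν a)) l (𝓝 (ballRank s O r μ))) :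
    Tendsto (fun a => clusterRank s (O' a) (ν a)) l (𝓝 (clusterRank s O μ)) := by
  have h_inv : Tendsto (fun r : ℕ => ((r : ℝ) + 1)⁻¹) atTop (𝓝 0) := by
    simpa using tendsto_one_div_add_atTop_nhds_zero_nat (𝕜 := ℝ)
  have h_uniform : TendstoUniformlyOnFilter (fun r a => ballRank s (O' a) r (ν a))
      (fun a => clusterRank s (O' a) (ν a)) atTop l := by
    refine Metric.tendstoUniformlyOnFilter_iff.2 fun ε hε => ?_
    filter_upwards [(h_inv.eventually_lt_const hε).prod_inl l] with ⟨r, a⟩ hr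
    rw [dist_comm]
    exact (abs_ballRank_sub_clusterRank_le hs (hO' a) r).trans_lt hr
  refine h_uniform.tendsto_of_eventually_tendsto (Eventually.of_forall h) ?_
  rw [tendsto_iff_dist_tendsto_zero]
  exact squeeze_zero (fun _ => dist_nonneg) (abs_ballRank_sub_clusterRank_le hs hO) h_inv

theorem abs_ballRank_sub_le [IsFiniteMeasure μ] (hs : ∀ j, MeasurePreserving (s j) μ μ)
    (hO : ∀ j, MeasurableSet (O j)) (hO' : ∀ j, MeasurableSet (O' j)) (r : ℕ) :
    |ballRank s O r μ - ballRank s O' r μ| ≤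
      {w : List ι | w.length ≤ r}.ncard * μ.real (⋃ j, symmDiff (O j) (O' j)) := by
  have hs' := fun j => (hs j).measurable
  set B := ⋃ j, symmDiff (O j) (O' j)
  have hB : MeasurableSet B := MeasurableSet.iUnion fun j => (hO j).symmDiff (hO' j)
  have hfin : {w : List ι | w.length ≤ r}.Finite := List.finite_length_le ι r
  let S := ⋃ w ∈ hfin.toFinset, wordAct s w ⁻¹' B
  have hS : MeasurableSet S :=
    Finset.measurableSet_biUnion _ fun w _ => measurable_wordAct hs' w hB
  have h_bound (x : Ω) : ‖(1 - ((clusterBall s O r x).ncard : ℝ)⁻¹) -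
      (1 - ((clusterBall s O' r x).ncard : ℝ)⁻¹)‖ ≤ S.indicator 1 x := by
    rw [sub_sub_sub_cancel_left, Real.norm_eq_abs]
    by_cases hx : x ∈ S
    · rw [Set.indicator_of_mem hx]
      exact abs_inv_natCast_sub_inv_natCast_le _ _
    · have h_eq : (clusterBall s O r x).ncard = (clusterBall s O' r x).ncard :=
        ncard_clusterBall_eq_of_notMem_symmDiff fun w hw j hj =>
          hx (Set.mem_biUnion (hfin.mem_toFinset.2 hw) (Set.mem_iUnion_of_mem j hj))
      rw [Set.indicator_of_notMem hx, h_eq, sub_self, abs_zero]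
  calc |ballRank s O r μ - ballRank s O' r μ|
    _ ≤ ∫ x, S.indicator 1 x ∂μ := by
        rw [ballRank, ballRank, ← integral_sub
          (integrable_one_sub_inv (measurable_inv_ncard_clusterBall hs' hO r))
          (integrable_one_sub_inv (measurable_inv_ncard_clusterBall hs' hO' r))]
        exact norm_integral_le_of_norm_le ((integrable_const 1).indicator hS) (ae_of_all _ h_bound)
    _ = μ.real S := integral_indicator_one hS
    _ ≤ ∑ w ∈ hfin.toFinset, μ.real (wordAct s w ⁻¹' B) := measureReal_biUnion_finset_le _ _
    _ = {w : List ι | w.length ≤ r}.ncard * μ.real B := by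
        simp only [(measurePreserving_wordAct hs _).measureReal_preimage hB.nullMeasurableSet,
          Finset.sum_const, nsmul_eq_mul, Set.ncard_eq_toFinset_card _ hfin]

theorem tendsto_clusterRank_of_tendsto_symmDiff [IsProbabilityMeasure μ]
    (hs : ∀ j, MeasurePreserving (s j) μ μ) {α : Type*} {l : Filter α} {O' : α → ι → Set Ω}
    (hO' : ∀ a j, MeasurableSet (O' a j)) (hO : ∀ j, MeasurableSet (O j))
    (h : ∀ j, Tendsto (fun a => μ.real (symmDiff (O' a j) (O j))) l (𝓝 0)) :
    Tendsto (fun a => clusterRank s (O' a) μ) l (𝓝 (clusterRank s O μ)) := by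
  have := Fintype.ofFinite ι
  have h_union : Tendsto (fun a => μ.real (⋃ j, symmDiff (O' a j) (O j))) l (𝓝 0) := by
    refine squeeze_zero (fun _ => measureReal_nonneg)
      (fun a => measureReal_iUnion_fintype_le _) ?_
    simpa using tendsto_finsetSum Finset.univ fun j _ => h j
  refine tendsto_clusterRank_of_tendsto_ballRank (fun j => (hs j).measurable) hO' hO fun r => ?_
  rw [tendsto_iff_dist_tendsto_zero]
  refine squeeze_zero (fun _ => dist_nonneg) (fun a => abs_ballRank_sub_le hs (hO' a) hO r) ?_
  simpa using h_union.const_mul ({w : List ι | w.length ≤ r}.ncard : ℝ)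

theorem IsFaithfulHom.clusterRank_map {Ω₀ : Type*} [MeasurableSpace Ω₀] {s₀ : ι → Ω₀ → Ω₀}
    {f : Ω₀ → Ω} (hf : IsFaithfulHom s₀ s f) (hf_meas : Measurable f) (hs : ∀ j, Measurable (s j))
    (hO : ∀ j, MeasurableSet (O j)) (ν : Measure Ω₀) :
    clusterRank s O (ν.map f) = clusterRank s₀ (fun j => f ⁻¹' O j) ν := by
  have h_meas : Measurable fun x => 1 - ((cluster s O x).ncard : ℝ)⁻¹ :=
    measurable_const.sub (measurable_inv_ncard_cluster hs hO)
  rw [clusterRank, integral_map hf_meas.aemeasurable h_meas.aestronglyMeasurable]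
  simp only [hf.ncard_cluster, clusterRank]

end ClusterRank

section EdgeColoring

/-- The colour `c j x` is a colour of the edge joining `x` to `s j x`: it is the same seen from
both endpoints. -/
def IsEdgeColoring {ι Ω X : Type*} (s : ι → Ω → Ω) (c : ι → Ω → X) : Prop :=
  ∀ j x, c j (s j x) = c j x

/-- The point of `𝒬_k` given by an edge colouring with `k` colours. -/
noncomputable def quotientVector {ι Ω : Type*} [MeasurableSpace Ω] {k : ℕ} (s : ι → Ω → Ω)
    (c : ι → Ω → Fin k) (μ : Measure Ω) : EuclideanSpace ℝ (Finset (Fin k)) :=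
  WithLp.toLp 2 fun A => clusterRank s (fun j => c j ⁻¹' (A : Set (Fin k))) μ

/-- The `k`-quotients of the rank function of the graphing generated by `s`, as the points given by
measurable edge colourings. -/
def edgeQuotientSet {ι Ω : Type*} [MeasurableSpace Ω] (k : ℕ) (s : ι → Ω → Ω) (μ : Measure Ω) :
    Set (EuclideanSpace ℝ (Finset (Fin k))) :=
  {v | ∃ c : ι → Ω → Fin k, IsEdgeColoring s c ∧ (∀ j, Measurable (c j)) ∧
    quotientVector s c μ = v}

/-- The edges of the graphing are the transpositions of measure preserving involutions with
disjoint matchings. -/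
structure Graphing.IsGeneratedBy (G : Graphing.{u}) {ι : Type*} (s : ι → G.Ω → G.Ω) : Prop
    extends IsMatchingFamily s where
  measurePreserving (j : ι) : MeasurePreserving (s j) G.μ G.μ
  graph_eq : G.graph = matchingGraph s

variable {ι : Type*} {G : Graphing.{u}} {s : ι → G.Ω → G.Ω}

namespace Graphing.IsGeneratedBy

theorem measurable (hG : G.IsGeneratedBy s) (j : ι) : Measurable (s j) :=
  (hG.measurePreserving j).measurable

theorem adj_iff (hG : G.IsGeneratedBy s) {x y : G.Ω} :
    G.graph.Adj x y ↔ x ≠ y ∧ ∃ j, s j x = y := by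
  rw [hG.graph_eq, hG.matchingGraph_adj]

theorem component_eq_cluster (hG : G.IsGeneratedBy s) {F : Set G.Edge} {O : ι → Set G.Ω}
    (hF : ∀ e : G.Edge, ∀ j x, e.1 = s(x, s j x) → (e ∈ F ↔ x ∈ O j)) (x : G.Ω) :
    G.component F x = cluster s O x := by
  ext y
  constructor
  · intro h
    induction (SimpleGraph.reachable_iff_reflTransGen _ _).1 h with
    | refl => exact ⟨[], trivial, rfl⟩
    | @tail y z hxy hyz ih =>
      obtain ⟨⟨e, he, heyz⟩, -⟩ := hyz
      have hadj : G.graph.Adj y z := (SimpleGraph.mem_edgeSet _).1 (heyz ▸ e.2)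
      obtain ⟨-, j, rfl⟩ := hG.adj_iff.1 hadj
      exact apply_mem_cluster (ih ((SimpleGraph.reachable_iff_reflTransGen _ _).2 hxy))
        ((hF e j y heyz).1 he)
  · refine fun h => cluster_subset_of_closed (S := G.component F x) .rfl (fun y hy j hj => ?_) h
    by_cases hne : y = s j y
    · exact hne ▸ hy
    have hadj : s(y, s j y) ∈ G.graph.edgeSet := hG.adj_iff.2 ⟨hne, j, rfl⟩
    exact hy.trans (SimpleGraph.Adj.reachable ⟨⟨⟨_, hadj⟩, (hF _ j y rfl).2 hj, rfl⟩, hne⟩)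

theorem toLp_rank_eq_quotientVector (hG : G.IsGeneratedBy s) {k : ℕ} {P : G.Edge → Fin k}
    {c : ι → G.Ω → Fin k} (hPc : ∀ e : G.Edge, ∀ j x, e.1 = s(x, s j x) → P e = c j x) :
    WithLp.toLp 2 (fun A : Finset (Fin k) => G.rank (P ⁻¹' A)) = quotientVector s c G.μ := by
  refine congrArg (WithLp.toLp 2) (funext fun A => integral_congr_ae (ae_of_all _ fun x => ?_))
  simp only
  rw [hG.component_eq_cluster (O := fun j => c j ⁻¹' A)]
  intro e j x he
  rw [Set.mem_preimage, hPc e j x he]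
  rfl

theorem exists_edge_eq (hG : G.IsGeneratedBy s) (e : G.Edge) : ∃ j x, e.1 = s(x, s j x) := by
  obtain ⟨⟨x, y⟩, he⟩ := e
  have hadj : G.graph.Adj x y := he
  obtain ⟨-, j, rfl⟩ := hG.adj_iff.1 hadj
  exact ⟨j, x, rfl⟩

theorem coloring_eq_of_edge_eq (hG : G.IsGeneratedBy s) {X : Type*} {c : ι → G.Ω → X}
    (hc : IsEdgeColoring s c) (e : G.Edge) {j k : ι} {x y : G.Ω} (hx : e.1 = s(x, s j x))
    (hy : e.1 = s(y, s k y)) : c j x = c k y := by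
  have hadj : s(x, s j x) ∈ G.graph.edgeSet := hx ▸ e.2
  have hne : s j x ≠ x := (hG.adj_iff.1 hadj).1.symm
  rcases Sym2.eq_iff.1 (hx.symm.trans hy) with ⟨rfl, h⟩ | ⟨hxy, rfl⟩
  · rw [hG.eq_of_apply_eq h hne]
  · have hjk : j = k := by
      refine hG.eq_of_apply_eq (x := s j x) ?_ ?_ <;> rw [hG.involutive j x]
      exacts [hxy, hne.symm]
    rw [← hjk, hc]

theorem measurable_of_isEdgeColoring [Countable ι] (hG : G.IsGeneratedBy s) {X : Type*}
    [MeasurableSpace X] {P : G.Edge → X} {c : ι → G.Ω → X} (hc : IsEdgeColoring s c)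
    (hc_meas : ∀ j, Measurable (c j))
    (hPc : ∀ e : G.Edge, ∀ j x, e.1 = s(x, s j x) → P e = c j x) : Measurable P := by
  intro T hT
  refine ⟨{e | ∃ j x, e = s(x, s j x) ∧ c j x ∈ T}, ?_, ?_⟩
  · have h_pairs : (fun p : G.Ω × G.Ω => s(p.1, p.2)) ⁻¹'
        {e | ∃ j x, e = s(x, s j x) ∧ c j x ∈ T} =
        ⋃ j, {p | p.2 = s j p.1} ∩ Prod.fst ⁻¹' (c j ⁻¹' T) := by
      ext ⟨x, y⟩
      simp only [Set.mem_preimage, Set.mem_ofPred_eq, Set.mem_iUnion, Set.mem_inter_iff]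
      refine exists_congr fun j => ⟨?_, fun ⟨hy, hT⟩ => ⟨x, by rw [hy], hT⟩⟩
      rintro ⟨z, hz, hT⟩
      rcases Sym2.eq_iff.1 hz with ⟨rfl, rfl⟩ | ⟨rfl, rfl⟩
      · exact ⟨rfl, hT⟩
      · exact ⟨(hG.involutive j y).symm, by rwa [hc]⟩
    change MeasurableSet ((fun p : G.Ω × G.Ω => s(p.1, p.2)) ⁻¹' _)
    rw [h_pairs]
    exact MeasurableSet.iUnion fun j =>
      (measurableSet_eq_fun measurable_snd ((hG.measurable j).comp measurable_fst)).inter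
        (measurable_fst (hc_meas j hT))
  · ext e
    constructor
    · rintro ⟨j, x, he, hT⟩
      rwa [Set.mem_preimage, hPc e j x he]
    · intro hT
      obtain ⟨j, x, he⟩ := hG.exists_edge_eq e
      exact ⟨j, x, he, by rwa [← hPc e j x he]⟩

end Graphing.IsGeneratedBy

theorem Graphing.measurable_extend_edge (G : Graphing.{u}) {X : Type*} [MeasurableSpace X]
    {P : G.Edge → X} (hP : Measurable P) (x₀ : X) {f : G.Ω → G.Ω} (hf : Measurable f) :
    Measurable fun x => Function.extend Subtype.val P (fun _ => x₀) s(x, f x) := by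
  let : MeasurableSpace (Sym2 G.Ω) :=
    MeasurableSpace.map (fun p : G.Ω × G.Ω => s(p.1, p.2)) inferInstance
  have hE : MeasurableSet G.graph.edgeSet := G.measurableSet_adj
  have h_mk : Measurable fun p : G.Ω × G.Ω => s(p.1, p.2) := fun _ h => h
  exact ((MeasurableEmbedding.subtype_coe hE).measurable_extend hP measurable_const).comp
    (h_mk.comp (measurable_id.prodMk hf))

theorem Graphing.IsGeneratedBy.quotientSet_rank_eq [Countable ι] (hG : G.IsGeneratedBy s)
    {k : ℕ} [NeZero k] :
    quotientSet k G.rank = edgeQuotientSet k s G.μ := by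
  ext v
  constructor
  · rintro ⟨P, hP, hv⟩
    let c (j : ι) (x : G.Ω) : Fin k := Function.extend Subtype.val P (fun _ => 0) s(x, s j x)
    refine ⟨c, fun j x => ?_, fun j => G.measurable_extend_edge hP 0 (hG.measurable j), ?_⟩
    · simp only [c, hG.involutive j x, Sym2.eq_swap]
    · rw [← hG.toLp_rank_eq_quotientVector (P := P)]
      · exact PiLp.ext fun A => (hv A).symm
      · rintro e j x he
        exact (he ▸ Subtype.val_injective.extend_apply P _ e).symm
  · rintro ⟨c, hc, hc_meas, rfl⟩
    choose j x h_eq using hG.exists_edge_eq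
    have hPc (e : G.Edge) (k y) (he : e.1 = s(y, s k y)) : c (j e) (x e) = c k y :=
      hG.coloring_eq_of_edge_eq hc e (h_eq e) he
    refine ⟨fun e => c (j e) (x e), hG.measurable_of_isEdgeColoring hc hc_meas hPc, fun A => ?_⟩
    rw [← hG.toLp_rank_eq_quotientVector hPc]

end EdgeColoring

section Generation

variable {ι Ω : Type*} [MeasurableSpace Ω] {s : ι → Ω → Ω}

theorem IsMatchingFamily.setLIntegral_encard_neighborSet_inter_eq_tsum [Countable ι]
    [MeasurableEq Ω] {μ : Measure Ω} (hs : IsMatchingFamily s) (hs_meas : ∀ j, Measurable (s j))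
    (A : Set Ω) {B : Set Ω} (hB : MeasurableSet B) :
    ∫⁻ x in A, (((matchingGraph s).neighborSet x ∩ B).encard : ℝ≥0∞) ∂μ =
      ∑' j, μ ({x | s j x ≠ x} ∩ s j ⁻¹' B ∩ A) := by
  have h_step (j : ι) : MeasurableSet ({x | s j x ≠ x} ∩ s j ⁻¹' B) :=
    (measurableSet_eq_fun (hs_meas j) measurable_id).compl.inter (hs_meas j hB)
  have h_encard (x : Ω) : (((matchingGraph s).neighborSet x ∩ B).encard : ℝ≥0∞) =
      ∑' j, ({x | s j x ≠ x} ∩ s j ⁻¹' B).indicator 1 x := by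
    rw [hs.encard_neighborSet_inter, ← ENNReal.tsum_set_one,
      tsum_subtype {j | s j x ≠ x ∧ s j x ∈ B} fun _ => (1 : ℝ≥0∞)]
    rfl
  simp only [h_encard]
  rw [lintegral_tsum fun j => (measurable_one.indicator (h_step j)).aemeasurable]
  simp only [lintegral_indicator_one (h_step _), Measure.restrict_apply (h_step _)]

theorem IsMatchingFamily.setLIntegral_encard_neighborSet_inter_comm [Countable ι]
    [MeasurableEq Ω] {μ : Measure Ω} (hs : IsMatchingFamily s)
    (hμ : ∀ j, MeasurePreserving (s j) μ μ) {A B : Set Ω} (hA : MeasurableSet A)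
    (hB : MeasurableSet B) :
    ∫⁻ x in A, (((matchingGraph s).neighborSet x ∩ B).encard : ℝ≥0∞) ∂μ =
      ∫⁻ x in B, (((matchingGraph s).neighborSet x ∩ A).encard : ℝ≥0∞) ∂μ := by
  have hs_meas := fun j => (hμ j).measurable
  rw [hs.setLIntegral_encard_neighborSet_inter_eq_tsum hs_meas A hB,
    hs.setLIntegral_encard_neighborSet_inter_eq_tsum hs_meas B hA]
  refine tsum_congr fun j => ?_
  have h_step : MeasurableSet ({x | s j x ≠ x} ∩ s j ⁻¹' B ∩ A) :=
    ((measurableSet_eq_fun (hs_meas j) measurable_id).compl.inter (hs_meas j hB)).inter hA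
  rw [← (hμ j).measure_preimage h_step.nullMeasurableSet]
  congr 1
  ext x
  simp only [Set.mem_preimage, Set.mem_inter_iff, Set.mem_ofPred_eq, hs.involutive j x,
    ne_comm (a := x), and_right_comm]

/-- The graphing whose edges are the transpositions of finitely many measure preserving
involutions. -/
def Graphing.ofMatchingFamily {Ω : Type u} [MeasurableSpace Ω] [StandardBorelSpace Ω] [Finite ι]
    {s : ι → Ω → Ω} (hs : IsMatchingFamily s) (μ : Measure Ω) [IsProbabilityMeasure μ]
    (hμ : ∀ j, MeasurePreserving (s j) μ μ) : Graphing.{u} where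
  Ω := Ω
  graph := matchingGraph s
  measurableSet_adj := by
    have h_adj : {p : Ω × Ω | (matchingGraph s).Adj p.1 p.2} =
        {p | p.1 = p.2}ᶜ ∩ ⋃ j, {p | s j p.1 = p.2} := by
      ext p
      simp [hs.matchingGraph_adj]
    rw [h_adj]
    exact (measurableSet_eq_fun measurable_fst measurable_snd).compl.inter
      (.iUnion fun j => measurableSet_eq_fun ((hμ j).measurable.comp measurable_fst) measurable_snd)
  bounded_degree := by
    refine ⟨Nat.card ι, fun x => ?_⟩
    rw [hs.encard_neighborSet, ← ENat.card_eq_coe_natCard, ← Set.encard_univ]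
    exact Set.encard_le_encard (Set.subset_univ _)
  μ := μ
  involution_invariant _ _ hA hB := hs.setLIntegral_encard_neighborSet_inter_comm hμ hA hB

theorem Graphing.isGeneratedBy_ofMatchingFamily {Ω : Type u} [MeasurableSpace Ω]
    [StandardBorelSpace Ω] [Finite ι] {s : ι → Ω → Ω} (hs : IsMatchingFamily s) (μ : Measure Ω)
    [IsProbabilityMeasure μ] (hμ : ∀ j, MeasurePreserving (s j) μ μ) :
    (Graphing.ofMatchingFamily hs μ hμ).IsGeneratedBy s where
  toIsMatchingFamily := hs
  measurePreserving := hμ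
  graph_eq := rfl

theorem Graphing.measure_singleton_eq_of_adj (G : Graphing.{u}) {x y : G.Ω}
    (h : G.graph.Adj x y) : G.μ {x} = G.μ {y} := by
  have h_one {x y : G.Ω} (h : G.graph.Adj x y) :
      ∫⁻ z in {x}, ((G.graph.neighborSet z ∩ {y}).encard : ℝ≥0∞) ∂G.μ = G.μ {x} := by
    have h_nbr : G.graph.neighborSet x ∩ {y} = {y} :=
      Set.inter_eq_right.2 (Set.singleton_subset_iff.2 h)
    rw [lintegral_singleton, h_nbr, Set.encard_singleton]
    simp
  rw [← h_one h, ← h_one h.symm]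
  exact G.involution_invariant _ _ (measurableSet_singleton x) (measurableSet_singleton y)

theorem Graphing.exists_isGeneratedBy (G : Graphing.{u}) [Countable G.Ω] {D : ℕ}
    (hD : ∀ x, (G.graph.neighborSet x).encard ≤ D) :
    ∃ s : Fin (2 * D + 1) → G.Ω → G.Ω, G.IsGeneratedBy s := by
  obtain ⟨s, hs, hG⟩ := exists_isMatchingFamily G.graph hD
  refine ⟨s, ⟨hs, fun j => ⟨measurable_of_countable _, ?_⟩, hG⟩⟩
  refine Measure.ext_iff_singleton.2 fun x => ?_
  have h_preimage : s j ⁻¹' {x} = {s j x} := by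
    ext y
    exact (hs.involutive j).eq_iff
  rw [Measure.map_apply (measurable_of_countable _) (measurableSet_singleton x), h_preimage]
  by_cases hx : s j x = x
  · rw [hx]
  · exact G.measure_singleton_eq_of_adj (hG ▸ hs.matchingGraph_adj.2 ⟨hx, j, hs.involutive j x⟩)

end Generation

section ClopenSystem

variable {ι K : Type*} [TopologicalSpace K] {s : ι → K → K}

/-- A system of continuous self-maps in which any two words that agree at a point agree near that
point, so that the local structure of the orbits is locally constant. -/
structure IsClopenSystem (s : ι → K → K) : Prop where
  continuous (j : ι) : Continuous (s j)
  isOpen_eq (w w' : List ι) : IsOpen {x | wordAct s w x = wordAct s w' x}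

theorem continuous_wordAct (hs : ∀ j, Continuous (s j)) (w : List ι) :
    Continuous (wordAct s w) := by
  induction w with
  | nil => exact continuous_id
  | cons j w ih => exact ih.comp (hs j)

theorem IsClopenSystem.isClopen_eq [T2Space K] (hs : IsClopenSystem s) (w w' : List ι) :
    IsClopen {x | wordAct s w x = wordAct s w' x} :=
  ⟨isClosed_eq (continuous_wordAct hs.continuous w) (continuous_wordAct hs.continuous w'),
    hs.isOpen_eq w w'⟩

theorem isClopen_admissible (hs : ∀ j, Continuous (s j)) {O : ι → Set K}
    (hO : ∀ j, IsClopen (O j)) (w : List ι) : IsClopen {x | Admissible s O w x} := by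
  induction w with
  | nil => exact isClopen_univ
  | cons j w ih => exact (hO j).inter (ih.preimage (hs j))

theorem isLocallyConstant_mem {S : Set K} (hS : IsClopen S) :
    IsLocallyConstant fun x => x ∈ S := by
  refine (IsLocallyConstant.iff_eventually_eq _).2 fun x => ?_
  by_cases hx : x ∈ S
  · filter_upwards [hS.isOpen.mem_nhds hx] with y hy using propext (iff_of_true hy hx)
  · filter_upwards [hS.compl.isOpen.mem_nhds hx] with y hy using propext (iff_of_false hy hx)

theorem IsClopenSystem.isLocallyConstant_ncard_clusterBall [Finite ι] [T2Space K]
    (hs : IsClopenSystem s) {O : ι → Set K} (hO : ∀ j, IsClopen (O j)) (r : ℕ) :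
    IsLocallyConstant fun x => (clusterBall s O r x).ncard := by
  refine (IsLocallyConstant.iff_eventually_eq _).2 fun x => ?_
  have hfin : {w : List ι | w.length ≤ r}.Finite := List.finite_length_le ι r
  have hadm : ∀ᶠ y in 𝓝 x, ∀ w : List ι, w.length ≤ r →
      Admissible s O w y = Admissible s O w x :=
    (eventually_all_finite hfin).2 fun w _ =>
      (isLocallyConstant_mem (isClopen_admissible hs.continuous hO w)).eventually_eq x
  have heq : ∀ᶠ y in 𝓝 x, ∀ w : List ι, w.length ≤ r → ∀ w' : List ι, w'.length ≤ r →
      (wordAct s w y = wordAct s w' y) = (wordAct s w x = wordAct s w' x) :=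
    (eventually_all_finite hfin).2 fun w _ => (eventually_all_finite hfin).2 fun w' _ =>
      (isLocallyConstant_mem (hs.isClopen_eq w w')).eventually_eq x
  filter_upwards [hadm, heq] with y hadm heq
  exact ncard_clusterBall_congr (fun w hw => iff_of_eq (hadm w hw))
    fun w w' hw hw' => iff_of_eq (heq w hw w' hw')

variable [CompactSpace K] [T2Space K] [SecondCountableTopology K] [MeasurableSpace K] [BorelSpace K]

theorem IsClopenSystem.continuous_clusterRank [Finite ι] (hs : IsClopenSystem s) {O : ι → Set K}
    (hO : ∀ j, IsClopen (O j)) :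
    Continuous fun μ : ProbabilityMeasure K => clusterRank s O (μ : Measure K) := by
  have hO_meas (j : ι) : MeasurableSet (O j) := (hO j).isOpen.measurableSet
  refine continuous_iff_continuousAt.2 fun μ => tendsto_clusterRank_of_tendsto_ballRank
    (fun j => (hs.continuous j).measurable) (fun _ => hO_meas) hO_meas fun r => ?_
  let f : C(K, ℝ) := ⟨fun x => 1 - ((clusterBall s O r x).ncard : ℝ)⁻¹,
    ((hs.isLocallyConstant_ncard_clusterBall hO r).comp fun n : ℕ => 1 - (n : ℝ)⁻¹).continuous⟩
  exact (ProbabilityMeasure.continuous_integral_continuousMap f).tendsto μ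

theorem IsClopenSystem.continuous_quotientVector [Finite ι] (hs : IsClopenSystem s) {k : ℕ}
    {c : ι → K → Fin k} (hc : ∀ j, Continuous (c j)) :
    Continuous fun μ : ProbabilityMeasure K => quotientVector s c (μ : Measure K) :=
  (PiLp.continuous_toLp 2 _).comp <| continuous_pi fun A =>
    hs.continuous_clusterRank fun j => (isClopen_discrete (A : Set (Fin k))).preimage (hc j)

theorem isClosed_setOf_measurePreserving {f : K → K} (hf : Continuous f) :
    IsClosed {μ : ProbabilityMeasure K | MeasurePreserving f (μ : Measure K) μ} := by
  have h_iff (μ : ProbabilityMeasure K) :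
      MeasurePreserving f (μ : Measure K) μ ↔ μ.map hf.measurable.aemeasurable = μ :=
    ⟨fun h => Subtype.ext h.map_eq, fun h => ⟨hf.measurable, congrArg Subtype.val h⟩⟩
  simp only [h_iff]
  exact isClosed_eq (ProbabilityMeasure.continuous_map hf) continuous_id

end ClopenSystem

section ContinuousApproximation

variable {K : Type*} [TopologicalSpace K] [CompactSpace K] [T2Space K]
  [SecondCountableTopology K] [TotallyDisconnectedSpace K] [MeasurableSpace K] [BorelSpace K]
  {μ : Measure K}

theorem exists_isClopen_measure_symmDiff_lt [IsFiniteMeasure μ] {S : Set K}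
    (hS : MeasurableSet S) {ε : ℝ≥0∞} (hε : 0 < ε) :
    ∃ T : Set K, IsClopen T ∧ μ (symmDiff T S) < ε := by
  have hring : IsSetRing {T : Set K | IsClopen T} :=
    ⟨isClopen_empty, fun _ _ => IsClopen.union, fun _ _ => IsClopen.diff⟩
  have hcover : ∃ 𝒟 : Set (Set K), 𝒟.Countable ∧ 𝒟 ⊆ {T | IsClopen T} ∧ μ (⋃₀ 𝒟)ᶜ = 0 :=
    ⟨{Set.univ}, Set.countable_singleton _, by simp [isClopen_univ], by simp⟩
  exact exists_measure_symmDiff_lt_of_generateFrom_isSetRing hring hcover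
    (BorelSpace.measurable_eq.trans isTopologicalBasis_isClopen.borel_eq_generateFrom) hS hε

theorem exists_continuous_measure_ne_lt [IsFiniteMeasure μ] {Y : Type*} [Finite Y]
    [TopologicalSpace Y] [MeasurableSpace Y] [MeasurableSingletonClass Y] {q : K → Y}
    (hq : Measurable q) {ε : ℝ≥0∞} (hε : 0 < ε) :
    ∃ q' : K → Y, Continuous q' ∧ μ {x | q' x ≠ q x} < ε := by
  rcases isEmpty_or_nonempty K with hK | hK
  · exact ⟨q, continuous_of_const fun x => hK.elim x, by simpa using hε⟩
  have : Nonempty Y := hK.map q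
  obtain ⟨δ, hδ, hδε⟩ := ENNReal.exists_pos_sum_of_countable' hε.ne' Y
  choose T hT hTμ using fun y => exists_isClopen_measure_symmDiff_lt (μ := μ)
    (hq (measurableSet_singleton y)) (hδ y)
  let fibre : Y → Y → Prop := fun y z => y = z
  have h_fibre : Function.Injective fibre := fun y z h => (congrFun h z).mpr rfl
  have hT_const : IsLocallyConstant fun x z => x ∈ T z := by
    refine (IsLocallyConstant.iff_eventually_eq _).2 fun x => ?_
    filter_upwards [eventually_all.2 fun z => (isLocallyConstant_mem (hT z)).eventually_eq x]
      with y hy using funext hy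
  refine ⟨fun x => Function.invFun fibre fun z => x ∈ T z,
    (hT_const.comp (Function.invFun fibre)).continuous, ?_⟩
  have h_subset : {x | Function.invFun fibre (fun z => x ∈ T z) ≠ q x} ⊆
      ⋃ y, symmDiff (T y) (q ⁻¹' {y}) := by
    intro x hx
    by_contra h_notMem
    have h_mem (y : Y) : x ∈ T y ↔ q x = y := by
      have := mt (Set.mem_iUnion_of_mem y) h_notMem
      simp only [Set.mem_symmDiff, Set.mem_preimage, Set.mem_singleton_iff] at this
      tauto
    exact hx (by simpa only [h_mem] using Function.leftInverse_invFun h_fibre (q x))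
  calc μ {x | Function.invFun fibre (fun z => x ∈ T z) ≠ q x}
    _ ≤ ∑' y, μ (symmDiff (T y) (q ⁻¹' {y})) :=
        (measure_mono h_subset).trans (measure_iUnion_le _)
    _ ≤ ∑' y, δ y := ENNReal.tsum_le_tsum fun y => (hTμ y).le
    _ < ε := hδε

theorem exists_continuous_tendsto_measure_ne [IsFiniteMeasure μ] {Y : Type*} [Finite Y]
    [TopologicalSpace Y] [MeasurableSpace Y] [MeasurableSingletonClass Y] {q : K → Y}
    (hq : Measurable q) :
    ∃ q' : ℕ → K → Y, (∀ n, Continuous (q' n)) ∧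
      Tendsto (fun n => μ {x | q' n x ≠ q x}) atTop (𝓝 0) := by
  obtain ⟨ε, -, hε, hε_lim⟩ := exists_seq_strictAnti_tendsto' (zero_lt_one (α := ℝ≥0∞))
  choose q' hq'_cont hq' using fun n => exists_continuous_measure_ne_lt (μ := μ) hq (hε n).1
  exact ⟨q', hq'_cont, tendsto_of_tendsto_of_tendsto_of_le_of_le tendsto_const_nhds hε_lim
    (fun _ => zero_le) fun n => (hq' n).le⟩

theorem exists_continuous_edgeColoring_tendsto [IsFiniteMeasure μ] {ι : Type*} {s : ι → K → K}
    (hs : ∀ j, Continuous (s j)) (hs_inv : ∀ j, Function.Involutive (s j))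
    (hμ : ∀ j, MeasurePreserving (s j) μ μ) {k : ℕ} {c : ι → K → Fin k} (hc : IsEdgeColoring s c)
    (hc_meas : ∀ j, Measurable (c j)) :
    ∃ c' : ℕ → ι → K → Fin k, (∀ n, IsEdgeColoring s (c' n)) ∧ (∀ n j, Continuous (c' n j)) ∧
      ∀ j, Tendsto (fun n => μ {x | c' n j x ≠ c j x}) atTop (𝓝 0) := by
  choose q hq_cont hq using fun j => exists_continuous_tendsto_measure_ne (μ := μ) (hc_meas j)
  -- The minimum over the two endpoints turns the approximation into an edge colouring.
  refine ⟨fun n j x => min (q j n x) (q j n (s j x)), fun n j x => ?_,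
    fun n j => (hq_cont j n).min ((hq_cont j n).comp (hs j)), fun j => ?_⟩
  · simp only [hs_inv j x, min_comm]
  have h_lim : Tendsto (fun n => μ {x | q j n x ≠ c j x} + μ {x | q j n x ≠ c j x}) atTop
      (𝓝 0) := by
    simpa using (hq j).add (hq j)
  refine tendsto_of_tendsto_of_tendsto_of_le_of_le tendsto_const_nhds h_lim (fun _ => zero_le)
    fun n => ?_
  have h_subset : {x | min (q j n x) (q j n (s j x)) ≠ c j x} ⊆
      {x | q j n x ≠ c j x} ∪ s j ⁻¹' {x | q j n x ≠ c j x} := by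
    intro x hx
    by_contra h
    simp only [Set.mem_union, Set.mem_preimage, Set.mem_ofPred_eq, not_or, not_not, hc j x] at h
    exact hx (by rw [h.1, h.2, min_self])
  have h_meas : MeasurableSet {x | q j n x ≠ c j x} :=
    (measurableSet_eq_fun (hq_cont j n).measurable (hc_meas j)).compl
  calc μ {x | min (q j n x) (q j n (s j x)) ≠ c j x}
    _ ≤ μ {x | q j n x ≠ c j x} + μ (s j ⁻¹' {x | q j n x ≠ c j x}) :=
        (measure_mono h_subset).trans (measure_union_le _ _)
    _ = μ {x | q j n x ≠ c j x} + μ {x | q j n x ≠ c j x} := by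
        rw [(hμ j).measure_preimage h_meas.nullMeasurableSet]

theorem quotientVector_mem_closure_continuous [IsProbabilityMeasure μ] {ι : Type*} [Finite ι]
    {s : ι → K → K} (hs : ∀ j, Continuous (s j)) (hs_inv : ∀ j, Function.Involutive (s j))
    (hμ : ∀ j, MeasurePreserving (s j) μ μ) {k : ℕ} {c : ι → K → Fin k} (hc : IsEdgeColoring s c)
    (hc_meas : ∀ j, Measurable (c j)) :
    quotientVector s c μ ∈ closure {v | ∃ c' : ι → K → Fin k, IsEdgeColoring s c' ∧
      (∀ j, Continuous (c' j)) ∧ quotientVector s c' μ = v} := by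
  obtain ⟨c', hc', hc'_cont, h_lim⟩ :=
    exists_continuous_edgeColoring_tendsto hs hs_inv hμ hc hc_meas
  have h_tendsto : Tendsto (fun n => quotientVector s (c' n) μ) atTop
      (𝓝 (quotientVector s c μ)) := by
    refine ((PiLp.continuous_toLp 2 _).tendsto _).comp (tendsto_pi_nhds.2 fun A => ?_)
    refine tendsto_clusterRank_of_tendsto_symmDiff hμ
      (fun n j => (hc'_cont n j).measurable .of_discrete) (fun j => hc_meas j .of_discrete)
      fun j => ?_
    refine squeeze_zero (fun _ => measureReal_nonneg) (fun n => ?_)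
      ((ENNReal.tendsto_toReal ENNReal.zero_ne_top).comp (h_lim j))
    refine measureReal_mono fun x hx h_eq => ?_
    rw [Set.mem_symmDiff, Set.mem_preimage, Set.mem_preimage, h_eq] at hx
    tauto
  exact mem_closure_of_tendsto h_tendsto (.of_forall fun n => ⟨c' n, hc' n, hc'_cont n, rfl⟩)

end ContinuousApproximation

section FaithfulHom

variable {ι W K : Type*} {a : ι → W → W} {s : ι → K → K} {f : W → K}

theorem IsFaithfulHom.comp {Ω : Type*} {b : ι → Ω → Ω} {g : Ω → W} (hf : IsFaithfulHom a s f)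
    (hg : IsFaithfulHom b a g) : IsFaithfulHom b s (f ∘ g) where
  map_apply j x := by rw [Function.comp_apply, hg.map_apply, hf.map_apply, Function.comp_apply]
  injOn_orbit x := by
    refine (hf.injOn_orbit (g x)).comp (hg.injOn_orbit x) ?_
    rintro _ ⟨w, rfl⟩
    exact ⟨w, (map_wordAct hg.map_apply w x).symm⟩

theorem IsFaithfulHom.wordAct_eq_iff (hf : IsFaithfulHom a s f) (w w' : List ι) (x : W) :
    wordAct s w (f x) = wordAct s w' (f x) ↔ wordAct a w x = wordAct a w' x := by
  rw [← map_wordAct hf.map_apply, ← map_wordAct hf.map_apply]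
  exact (hf.injOn_orbit x).eq_iff ⟨w, rfl⟩ ⟨w', rfl⟩

theorem isFaithfulHom_sigmaMk {α : Type*} {Ω : α → Type*} (b : ∀ i, ι → Ω i → Ω i) (i : α) :
    IsFaithfulHom (b i) (fun j => Sigma.map id fun i => b i j) (Sigma.mk i) where
  map_apply _ _ := rfl
  injOn_orbit _ := sigma_mk_injective.injOn

theorem IsMatchingFamily.sigmaMap {α : Type*} {Ω : α → Type*} {b : ∀ i, ι → Ω i → Ω i}
    (hb : ∀ i, IsMatchingFamily (b i)) :
    IsMatchingFamily fun j => Sigma.map id fun i => b i j where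
  involutive j := fun ⟨i, v⟩ => congrArg (Sigma.mk i) ((hb i).involutive j v)
  eq_of_apply_eq {_ _ x} h h_ne := by
    obtain ⟨i, v⟩ := x
    exact (hb i).eq_of_apply_eq (sigma_mk_injective h) fun hv => h_ne (congrArg (Sigma.mk i) hv)

variable [TopologicalSpace K]

theorem isEdgeColoring_of_denseRange (hf : DenseRange f) (h_map : ∀ j x, f (a j x) = s j (f x))
    (hs : ∀ j, Continuous (s j)) {X : Type*} [TopologicalSpace X] [T2Space X] {c : ι → K → X}
    (hc : ∀ j, Continuous (c j)) (h_color : IsEdgeColoring a fun j => c j ∘ f) :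
    IsEdgeColoring s c := by
  refine fun j x => hf.induction_on (p := fun x => c j (s j x) = c j x) x ?_ fun v => ?_
  · exact isClosed_eq ((hc j).comp (hs j)) (hc j)
  · rw [← h_map]
    exact h_color j v

variable [T2Space K]

theorem IsFaithfulHom.isMatchingFamily_of_denseRange (hf : IsFaithfulHom a s f)
    (hf_dense : DenseRange f) (hs : IsClopenSystem s) (ha : IsMatchingFamily a) :
    IsMatchingFamily s where
  involutive j := by
    refine fun x => hf_dense.induction_on (p := fun x => s j (s j x) = x) x ?_ fun v => ?_
    · exact isClosed_eq ((hs.continuous j).comp (hs.continuous j)) continuous_id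
    · rw [← hf.map_apply, ← hf.map_apply, ha.involutive j v]
  eq_of_apply_eq {j k x} h_eq h_ne := by
    by_contra h_jk
    refine h_ne (hf_dense.induction_on (p := fun x => s j x = s k x → s j x = x) x ?_
      (fun v h => ?_) h_eq)
    · exact isClosed_imp (hs.isOpen_eq [j] [k]) (isClosed_eq (hs.continuous j) continuous_id)
    · refine (hf.wordAct_eq_iff [j] [] v).2 (by_contra fun hv => h_jk ?_)
      exact ha.eq_of_apply_eq ((hf.wordAct_eq_iff [j] [k] v).1 h) hv

theorem IsFaithfulHom.encard_setOf_apply_ne_le_of_denseRange [Finite ι] (hf : IsFaithfulHom a s f)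
    (hf_dense : DenseRange f) (hs : IsClopenSystem s) {D : ℕ∞}
    (hD : ∀ v, {j | a j v ≠ v}.encard ≤ D) (x : K) : {j | s j x ≠ x}.encard ≤ D := by
  have h_near : ∀ᶠ y in 𝓝 x, ∀ j, (s j y = y) = (s j x = x) := eventually_all.2 fun j =>
    (isLocallyConstant_mem (hs.isClopen_eq [j] [])).eventually_eq x
  obtain ⟨v, hv⟩ := hf_dense.exists_mem_open isOpen_interior ⟨x, mem_interior_iff_mem_nhds.2 h_near⟩
  refine (Set.encard_le_encard fun j hj => ?_).trans (hD v)
  have h_fix : (s j (f v) = f v) = (s j x = x) := interior_subset hv j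
  exact fun h => hj (h_fix ▸ (hf.map_apply j v ▸ congrArg f h))

end FaithfulHom

section Itinerary

variable {ι W X : Type*} [TopologicalSpace X] {a : ι → W → W} {lab : W → X}

/-- The labels seen from `v` along all words, so that `v ↦ itinerary a lab v` intertwines the maps
`a j` with shifts. -/
def itinerary (a : ι → W → W) (lab : W → X) (v : W) : List ι → X :=
  fun w => lab (wordAct a w v)

/-- The closure of the set of itineraries: a symbolic compactification of the system `a`. -/
abbrev ItinerarySpace (a : ι → W → W) (lab : W → X) : Type _ :=
  closure (Set.range (itinerary a lab))

/-- A labelling that tells apart `wordAct a w v` and `wordAct a w' v`, whenever these differ, by a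
clopen condition on their labels which does not depend on `v`. -/
def IsSeparating (a : ι → W → W) (lab : W → X) : Prop :=
  ∀ w w' : List ι, ∃ C : Set (X × X), IsClopen C ∧ (∀ z, (z, z) ∈ C) ∧
    ∀ v, (lab (wordAct a w v), lab (wordAct a w' v)) ∈ C → wordAct a w v = wordAct a w' v

theorem exists_isSeparating (ha : ∀ j, Function.Injective (a j)) :
    ∃ lab : W → List ι × List ι → Fin 3, IsSeparating a lab := by
  choose col hcol using fun p : List ι × List ι => exists_fin_three_coloring_separating
    (injective_wordAct ha p.1) (injective_wordAct ha p.2)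
  refine ⟨fun v p => col p v, fun w w' => ⟨{z | z.1 (w, w') = z.2 (w, w')}, ?_, fun _ => rfl,
    fun v hv => hcol (w, w') v hv⟩⟩
  exact (isClopen_discrete (Set.diagonal (Fin 3))).preimage
    (f := fun z : (List ι × List ι → Fin 3) × (List ι × List ι → Fin 3) =>
      (z.1 (w, w'), z.2 (w, w'))) (by fun_prop)

theorem IsSeparating.prodMk (h : IsSeparating a lab) {Y : Type*} [TopologicalSpace Y]
    (lab' : W → Y) : IsSeparating a fun v => (lab v, lab' v) := by
  intro w w'
  obtain ⟨C, hC, h_diag, h_sep⟩ := h w w'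
  exact ⟨Prod.map Prod.fst Prod.fst ⁻¹' C,
    hC.preimage (continuous_fst.prodMap continuous_fst), fun z => h_diag z.1, h_sep⟩

namespace ItinerarySpace

instance [CompactSpace X] : CompactSpace (ItinerarySpace a lab) :=
  isCompact_iff_compactSpace.1 isClosed_closure.isCompact

instance [SecondCountableTopology X] [MeasurableSpace X] [BorelSpace X] [Countable ι] :
    BorelSpace (ItinerarySpace a lab) :=
  inferInstance

/-- The itinerary of a point, as an element of the compactification. -/
def ofPoint (a : ι → W → W) (lab : W → X) (v : W) : ItinerarySpace a lab :=
  ⟨itinerary a lab v, subset_closure ⟨v, rfl⟩⟩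

theorem denseRange_ofPoint : DenseRange (ofPoint a lab) := by
  refine Subtype.dense_iff.2 ?_
  rw [← Set.range_comp]
  exact subset_rfl

theorem mapsTo_shift (a : ι → W → W) (lab : W → X) (j : ι) :
    Set.MapsTo (fun (ω : List ι → X) w => ω (j :: w)) (closure (Set.range (itinerary a lab)))
      (closure (Set.range (itinerary a lab))) := by
  refine Set.MapsTo.closure ?_ (by fun_prop)
  rintro _ ⟨v, rfl⟩
  exact ⟨a j v, rfl⟩

/-- The continuous extension of `a j` to the compactification. -/
def shift (a : ι → W → W) (lab : W → X) (j : ι) : ItinerarySpace a lab → ItinerarySpace a lab :=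
  (mapsTo_shift a lab j).restrict

theorem continuous_shift (j : ι) : Continuous (shift a lab j) :=
  Continuous.restrict _ (by fun_prop)

theorem ofPoint_apply (j : ι) (v : W) : ofPoint a lab (a j v) = shift a lab j (ofPoint a lab v) :=
  rfl

theorem wordAct_shift_apply (w w' : List ι) (x : ItinerarySpace a lab) :
    (wordAct (shift a lab) w x).1 w' = x.1 (w ++ w') := by
  induction w generalizing x with
  | nil => rfl
  | cons j _ ih => exact ih (shift a lab j x)

theorem isFaithfulHom_ofPoint (h_sep : IsSeparating a lab) :
    IsFaithfulHom a (shift a lab) (ofPoint a lab) where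
  map_apply := ofPoint_apply
  injOn_orbit v := by
    rintro _ ⟨w, rfl⟩ _ ⟨w', rfl⟩ h
    obtain ⟨C, -, h_diag, hC⟩ := h_sep w w'
    have h_lab : lab (wordAct a w v) = lab (wordAct a w' v) := congrFun (congrArg Subtype.val h) []
    exact hC v (h_lab ▸ h_diag _)

theorem isClopenSystem_shift [T2Space X] (h_sep : IsSeparating a lab) :
    IsClopenSystem (shift a lab) where
  continuous := continuous_shift
  isOpen_eq w w' := by
    obtain ⟨C, hC, h_diag, h_eq⟩ := h_sep w w'
    have h_labels : Continuous fun x : ItinerarySpace a lab => (x.1 w, x.1 w') :=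
      ((continuous_apply w).comp continuous_subtype_val).prodMk
        ((continuous_apply w').comp continuous_subtype_val)
    suffices h : {x | wordAct (shift a lab) w x = wordAct (shift a lab) w' x} =
        (fun x : ItinerarySpace a lab => (x.1 w, x.1 w')) ⁻¹' C from
      h ▸ hC.isOpen.preimage h_labels
    refine Set.Subset.antisymm (fun x hx => ?_) fun x => ?_
    · have hx' := congrFun (congrArg Subtype.val hx) []
      rw [wordAct_shift_apply, wordAct_shift_apply, List.append_nil, List.append_nil] at hx'
      rw [Set.mem_preimage, hx']
      exact h_diag _
    · refine denseRange_ofPoint.induction_on (p := fun x : ItinerarySpace a lab =>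
        (x.1 w, x.1 w') ∈ C → wordAct (shift a lab) w x = wordAct (shift a lab) w' x) x ?_ ?_
      · exact isClosed_imp (hC.isOpen.preimage h_labels)
          (isClosed_eq (continuous_wordAct continuous_shift w)
            (continuous_wordAct continuous_shift w'))
      · intro v hv
        rw [← map_wordAct ofPoint_apply, ← map_wordAct ofPoint_apply, h_eq v hv]

end ItinerarySpace

end Itinerary

section Hausdorff

open Metric

variable {E : Type*} [PseudoEMetricSpace E]

theorem exists_tendsto_of_tendsto_hausdorffEDist {Q : ℕ → Set E} {A : Set E}
    (hA : Tendsto (fun i => hausdorffEDist (Q i) A) atTop (𝓝 0)) (hQ : ∀ i, (Q i).Nonempty)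
    {x : E} (hx : x ∈ A) : ∃ u : ℕ → E, (∀ i, u i ∈ Q i) ∧ Tendsto u atTop (𝓝 x) := by
  have h_near (i : ℕ) : ∃ y ∈ Q i, edist x y ≤ infEDist x (Q i) + (i : ℝ≥0∞)⁻¹ := by
    obtain h_top | h_top := eq_or_ne (infEDist x (Q i)) ⊤
    · obtain ⟨y, hy⟩ := hQ i
      exact ⟨y, hy, by simp [h_top]⟩
    · obtain ⟨y, hy, hxy⟩ := infEDist_lt_iff.1 (ENNReal.lt_add_right h_top
        (ENNReal.inv_ne_zero.2 (ENNReal.natCast_ne_top i)))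
      exact ⟨y, hy, hxy.le⟩
  choose u hu h_edist using h_near
  have h_bound : Tendsto (fun i : ℕ => hausdorffEDist (Q i) A + (i : ℝ≥0∞)⁻¹) atTop (𝓝 0) := by
    simpa using hA.add ENNReal.tendsto_inv_nat_nhds_zero
  refine ⟨u, hu, tendsto_iff_edist_tendsto_0.2 <| tendsto_of_tendsto_of_tendsto_of_le_of_le
    tendsto_const_nhds h_bound (fun _ => zero_le) fun i => ?_⟩
  calc edist (u i) x
    _ ≤ infEDist x (Q i) + (i : ℝ≥0∞)⁻¹ := edist_comm x (u i) ▸ h_edist i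
    _ ≤ hausdorffEDist (Q i) A + (i : ℝ≥0∞)⁻¹ := by
        rw [hausdorffEDist_comm]
        gcongr
        exact infEDist_le_hausdorffEDist_of_mem hx

theorem exists_dense_seq_tendsto_of_tendsto_hausdorffEDist [SecondCountableTopology E]
    {Q : ℕ → Set E} {A : Set E} (hA : Tendsto (fun i => hausdorffEDist (Q i) A) atTop (𝓝 0))
    (hQ : ∀ i, (Q i).Nonempty) :
    ∃ x : ℕ → E, A ⊆ closure (Set.range x) ∧
      ∀ n, ∃ u : ℕ → E, (∀ i, u i ∈ Q i) ∧ Tendsto u atTop (𝓝 (x n)) := by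
  obtain ⟨i, hi⟩ := (hA.eventually_lt_const ENNReal.zero_lt_top).exists
  have : Nonempty A := (nonempty_of_hausdorffEDist_ne_top (hQ i) hi.ne).to_subtype
  refine ⟨fun n => TopologicalSpace.denseSeq A n, ?_, fun n =>
    exists_tendsto_of_tendsto_hausdorffEDist hA hQ (TopologicalSpace.denseSeq A n).2⟩
  have h_dense := Subtype.dense_iff.1 (TopologicalSpace.denseRange_denseSeq A)
  rwa [← Set.range_comp] at h_dense

theorem mem_closure_of_tendsto_hausdorffEDist {α : Type*} {l : Filter α} [l.NeBot]
    {Q : α → Set E} {A : Set E} (hA : Tendsto (fun i => hausdorffEDist (Q i) A) l (𝓝 0))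
    {u : α → E} (hu : ∀ i, u i ∈ Q i) {x : E} (hx : Tendsto u l (𝓝 x)) : x ∈ closure A := by
  have h_le (i : α) : infEDist x A ≤ edist (u i) x + hausdorffEDist (Q i) A := by
    rw [add_comm, edist_comm]
    exact infEDist_le_infEDist_add_edist.trans
      (add_le_add_left (infEDist_le_hausdorffEDist_of_mem (hu i)) _)
  have h_lim := (tendsto_iff_edist_tendsto_0.1 hx).add hA
  rw [add_zero] at h_lim
  exact mem_closure_iff_infEDist_zero.2 (nonpos_iff_eq_zero.1 (ge_of_tendsto' h_lim h_le))

end Hausdorff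

section LimitSystem

variable {α ι K : Type*} [TopologicalSpace K] [CompactSpace K] [T2Space K]
  [SecondCountableTopology K] [MeasurableSpace K] [BorelSpace K] {Ω : α → Type*}
  [∀ i, MeasurableSpace (Ω i)] {a : ∀ i, ι → Ω i → Ω i} {s : ι → K → K} {π : ∀ i, Ω i → K}
  {ν : ∀ i, ProbabilityMeasure (Ω i)} {μ : ProbabilityMeasure K} {l : Filter α} {k : ℕ}

theorem exists_measurePreserving_limit (hs : ∀ j, Continuous (s j))
    (h_map : ∀ i j x, π i (a i j x) = s j (π i x)) (hπ_meas : ∀ i, Measurable (π i))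
    (hν : ∀ i j, MeasurePreserving (a i j) (ν i : Measure (Ω i)) (ν i)) (U : Ultrafilter α) :
    ∃ μ : ProbabilityMeasure K, (∀ j, MeasurePreserving (s j) (μ : Measure K) μ) ∧
      Tendsto (fun i => (ν i).map (hπ_meas i).aemeasurable) U (𝓝 μ) := by
  obtain ⟨μ, -, hμ⟩ := isCompact_univ.ultrafilter_le_nhds
    (U.map fun i => (ν i).map (hπ_meas i).aemeasurable) (by simp)
  refine ⟨μ, fun j => ?_, hμ⟩
  refine (isClosed_setOf_measurePreserving (hs j)).mem_of_tendsto hμ (.of_forall fun i => ?_)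
  refine ⟨(hs j).measurable, ?_⟩
  have h_comp : s j ∘ π i = π i ∘ a i j := funext fun x => (h_map i j x).symm
  rw [ProbabilityMeasure.toMeasure_map, Measure.map_map (hs j).measurable (hπ_meas i), h_comp,
    ← Measure.map_map (hπ_meas i) (hν i j).measurable, (hν i j).map_eq]

variable [Finite ι]

theorem IsClopenSystem.tendsto_quotientVector (hs : IsClopenSystem s)
    (hπ : ∀ i, IsFaithfulHom (a i) s (π i)) (hπ_meas : ∀ i, Measurable (π i))
    (hμ : Tendsto (fun i => (ν i).map (hπ_meas i).aemeasurable) l (𝓝 μ)) {c : ι → K → Fin k}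
    (hc : ∀ j, Continuous (c j)) :
    Tendsto (fun i => quotientVector (a i) (fun j => c j ∘ π i) (ν i : Measure (Ω i))) l
      (𝓝 (quotientVector s c (μ : Measure K))) := by
  refine (((hs.continuous_quotientVector hc).tendsto μ).comp hμ).congr fun i => ?_
  refine congrArg (WithLp.toLp 2) (funext fun A => ?_)
  exact (hπ i).clusterRank_map (hπ_meas i) (fun j => (hs.continuous j).measurable)
    (fun j => (hc j).measurable .of_discrete) _

theorem IsClopenSystem.mem_edgeQuotientSet_of_tendsto [l.NeBot] (hs : IsClopenSystem s)
    (hπ : ∀ i, IsFaithfulHom (a i) s (π i)) (hπ_meas : ∀ i, Measurable (π i))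
    (hμ : Tendsto (fun i => (ν i).map (hπ_meas i).aemeasurable) l (𝓝 μ)) {c : ι → K → Fin k}
    (hc : IsEdgeColoring s c) (hc_cont : ∀ j, Continuous (c j))
    {x : EuclideanSpace ℝ (Finset (Fin k))}
    (hx : Tendsto (fun i => quotientVector (a i) (fun j => c j ∘ π i) (ν i : Measure (Ω i))) l
      (𝓝 x)) : x ∈ edgeQuotientSet k s (μ : Measure K) :=
  ⟨c, hc, fun j => (hc_cont j).measurable,
    tendsto_nhds_unique (hs.tendsto_quotientVector hπ hπ_meas hμ hc_cont) hx⟩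

theorem IsClopenSystem.edgeQuotientSet_subset_closure [TotallyDisconnectedSpace K] [l.NeBot]
    (hs : IsClopenSystem s) (hs_inv : ∀ j, Function.Involutive (s j))
    (hπ : ∀ i, IsFaithfulHom (a i) s (π i)) (hπ_meas : ∀ i, Measurable (π i))
    (hμ_inv : ∀ j, MeasurePreserving (s j) (μ : Measure K) μ)
    (hμ : Tendsto (fun i => (ν i).map (hπ_meas i).aemeasurable) l (𝓝 μ))
    {A : Set (EuclideanSpace ℝ (Finset (Fin k)))}
    (hA : Tendsto (fun i => Metric.hausdorffEDist
      (edgeQuotientSet k (a i) (ν i : Measure (Ω i))) A) l (𝓝 0)) :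
    edgeQuotientSet k s (μ : Measure K) ⊆ closure A := by
  rintro _ ⟨c, hc, hc_meas, rfl⟩
  refine closure_minimal ?_ isClosed_closure
    (quotientVector_mem_closure_continuous hs.continuous hs_inv hμ_inv hc hc_meas)
  rintro _ ⟨c', hc', hc'_cont, rfl⟩
  refine mem_closure_of_tendsto_hausdorffEDist hA (fun i => ?_)
    (hs.tendsto_quotientVector hπ hπ_meas hμ hc'_cont)
  refine ⟨_, fun j x => ?_, fun j => (hc'_cont j).measurable.comp (hπ_meas i), rfl⟩
  rw [Function.comp_apply, (hπ i).map_apply, hc', Function.comp_apply]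

end LimitSystem

section LimitGraphing

theorem Graphing.IsGeneratedBy.encard_neighborSet {G : Graphing.{u}} {ι : Type*}
    {s : ι → G.Ω → G.Ω} (hG : G.IsGeneratedBy s) (x : G.Ω) :
    (G.graph.neighborSet x).encard = {j | s j x ≠ x}.encard := by
  rw [hG.graph_eq, hG.toIsMatchingFamily.encard_neighborSet]

variable {α : Type*} {l : Filter α} [l.NeBot] {Γ : α → Graphing.{u}} [∀ i, Countable (Γ i).Ω]

theorem exists_limit_graphing_of_compactification {ι : Type*} [Finite ι]
    {s : ∀ i, ι → (Γ i).Ω → (Γ i).Ω} (hΓ : ∀ i, (Γ i).IsGeneratedBy (s i)) {D : ℕ∞}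
    (hD : ∀ i x, ((Γ i).graph.neighborSet x).encard ≤ D) {K : Type v} [TopologicalSpace K]
    [CompactSpace K] [T2Space K] [SecondCountableTopology K] [TotallyDisconnectedSpace K]
    [MeasurableSpace K] [BorelSpace K] {t : ι → K → K}
    (ht : IsClopenSystem t) {f : (Σ i, (Γ i).Ω) → K}
    (hf : IsFaithfulHom (fun j => Sigma.map id fun i => s i j) t f) (hf_dense : DenseRange f) :
    ∃ H : Graphing.{v}, (∀ x, (H.graph.neighborSet x).encard ≤ D) ∧
      (∀ (k : ℕ) [NeZero k] (A : Set (EuclideanSpace ℝ (Finset (Fin k)))),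
        Tendsto (fun i => Metric.hausdorffEDist (quotientSet k (Γ i).rank) A) l (𝓝 0) →
          quotientSet k H.rank ⊆ closure A) ∧
      ∀ (k : ℕ) [NeZero k] (c : ι → K → Fin k), (∀ j, Continuous (c j)) → IsEdgeColoring t c →
        ∀ x, Tendsto (fun i => quotientVector (s i) (fun j v => c j (f ⟨i, v⟩)) (Γ i).μ) l (𝓝 x) →
          x ∈ quotientSet k H.rank := by
  have : StandardBorelSpace K :=
    letI := TopologicalSpace.metrizableSpaceMetric K
    inferInstance
  have ht_match : IsMatchingFamily t :=
    hf.isMatchingFamily_of_denseRange hf_dense ht (.sigmaMap fun i => (hΓ i).toIsMatchingFamily)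
  let π (i : α) (v : (Γ i).Ω) : K := f ⟨i, v⟩
  have hπ (i : α) : IsFaithfulHom (s i) t (π i) := hf.comp (isFaithfulHom_sigmaMk s i)
  have hπ_meas (i : α) : Measurable (π i) := measurable_of_countable _
  obtain ⟨μ, hμ_inv, hμ⟩ := exists_measurePreserving_limit (ν := fun i => ⟨(Γ i).μ, inferInstance⟩)
    ht.continuous (fun i => (hπ i).map_apply) hπ_meas (fun i => (hΓ i).measurePreserving)
    (Ultrafilter.of l)
  have hH := Graphing.isGeneratedBy_ofMatchingFamily ht_match (μ : Measure K) hμ_inv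
  refine ⟨.ofMatchingFamily ht_match (μ : Measure K) hμ_inv, fun x => ?_, fun k _ A hA => ?_,
    fun k _ c hc_cont hc x hx => ?_⟩
  · refine (hH.encard_neighborSet x).trans_le
      (hf.encard_setOf_apply_ne_le_of_denseRange hf_dense ht (fun ⟨i, v⟩ => ?_) x)
    refine le_trans (Set.encard_le_encard fun j hj => ?_) ((hΓ i).encard_neighborSet v ▸ hD i v)
    exact fun h => hj (congrArg (Sigma.mk i) h)
  · rw [hH.quotientSet_rank_eq]
    simp only [(hΓ _).quotientSet_rank_eq] at hA
    exact ht.edgeQuotientSet_subset_closure ht_match.involutive hπ hπ_meas hμ_inv hμ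
      (hA.mono_left (Ultrafilter.of_le l))
  · rw [hH.quotientSet_rank_eq]
    exact ht.mem_edgeQuotientSet_of_tendsto hπ hπ_meas hμ hc hc_cont
      (hx.mono_left (Ultrafilter.of_le l))

theorem exists_limit_graphing {ι : Type} [Finite ι] {s : ∀ i, ι → (Γ i).Ω → (Γ i).Ω}
    (hΓ : ∀ i, (Γ i).IsGeneratedBy (s i)) {D : ℕ∞}
    (hD : ∀ i x, ((Γ i).graph.neighborSet x).encard ≤ D) {N : Type} [Countable N] {m : N → ℕ}
    [∀ n, NeZero (m n)] {c : ∀ n i, ι → (Γ i).Ω → Fin (m n)}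
    (hc : ∀ n i, IsEdgeColoring (s i) (c n i)) :
    ∃ H : Graphing.{0}, (∀ x, (H.graph.neighborSet x).encard ≤ D) ∧
      (∀ (k : ℕ) [NeZero k] (A : Set (EuclideanSpace ℝ (Finset (Fin k)))),
        Tendsto (fun i => Metric.hausdorffEDist (quotientSet k (Γ i).rank) A) l (𝓝 0) →
          quotientSet k H.rank ⊆ closure A) ∧
      ∀ n x, Tendsto (fun i => quotientVector (s i) (c n i) (Γ i).μ) l (𝓝 x) →
        x ∈ quotientSet (m n) H.rank := by
  let a (j : ι) : (Σ i, (Γ i).Ω) → Σ i, (Γ i).Ω := Sigma.map id fun i => s i j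
  have ha : IsMatchingFamily a := .sigmaMap fun i => (hΓ i).toIsMatchingFamily
  obtain ⟨lab₀, h_sep₀⟩ := exists_isSeparating fun j => (ha.involutive j).injective
  let lab (v : Σ i, (Γ i).Ω) := (lab₀ v, fun (n : N) (j : ι) => c n v.1 j v.2)
  have h_sep : IsSeparating a lab := h_sep₀.prodMk _
  have h_hom := ItinerarySpace.isFaithfulHom_ofPoint h_sep
  have h_system := ItinerarySpace.isClopenSystem_shift h_sep
  have h_dense := ItinerarySpace.denseRange_ofPoint (a := a) (lab := lab)
  have h_color (n : N) (j : ι) : Continuous fun x : ItinerarySpace a lab => (x.1 []).2 n j :=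
    ((continuous_apply_apply n j).comp continuous_snd).comp
      ((continuous_apply []).comp continuous_subtype_val)
  obtain ⟨H, hH_deg, hH_subset, hH_mem⟩ :=
    exists_limit_graphing_of_compactification (l := l) hΓ hD h_system h_hom h_dense
  refine ⟨H, hH_deg, hH_subset, fun n => hH_mem (m n) (fun j x => (x.1 []).2 n j) (h_color n) ?_⟩
  exact isEdgeColoring_of_denseRange h_dense h_hom.map_apply h_system.continuous (h_color n)
    fun j v => hc n v.1 j v.2

end LimitGraphing

theorem quotientSet_nonempty {J : Type*} [MeasurableSpace J] (k : ℕ) [NeZero k] (φ : Set J → ℝ) :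
    (quotientSet k φ).Nonempty :=
  ⟨WithLp.toLp 2 fun A => φ ((fun _ => 0) ⁻¹' (A : Set (Fin k))), fun _ => 0, measurable_const,
    fun _ => rfl⟩

theorem theorem1p3_general {Γ : ℕ → Graphing.{u}} [∀ i, Countable (Γ i).Ω] {D : ℕ}
    (hD : ∀ i x, ((Γ i).graph.neighborSet x).encard ≤ D)
    (hconv : QuotientConvergent fun i => (Γ i).rank) :
    ∃ H : Graphing.{0}, (∀ x, (H.graph.neighborSet x).encard ≤ D) ∧
      QuotientConvergesTo (fun i => (Γ i).rank) H.rank := by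
  choose s hs using fun i => (Γ i).exists_isGeneratedBy (hD i)
  choose A hA using fun k : ℕ => hconv (k + 1) k.succ_pos
  choose x hx_dense u hu hu_lim using fun k =>
    exists_dense_seq_tendsto_of_tendsto_hausdorffEDist (hA k)
      fun i => quotientSet_nonempty (k + 1) (Γ i).rank
  have hu_mem (p : ℕ × ℕ) (i : ℕ) : u p.1 p.2 i ∈ edgeQuotientSet (p.1 + 1) (s i) (Γ i).μ :=
    (hs i).quotientSet_rank_eq.subset (hu p.1 p.2 i)
  choose c hc _ hcu using hu_mem
  obtain ⟨H, hH_deg, hH_subset, hH_mem⟩ :=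
    exists_limit_graphing (l := atTop) hs hD (m := fun p : ℕ × ℕ => p.1 + 1) hc
  refine ⟨H, hH_deg, fun k hk => ?_⟩
  obtain ⟨k, rfl⟩ := Nat.exists_eq_add_of_le' hk
  have h_mem (n : ℕ) : x k n ∈ quotientSet (k + 1) H.rank :=
    hH_mem (k, n) _ ((hu_lim k n).congr fun i => (hcu (k, n) i).symm)
  have h_closure : closure (quotientSet (k + 1) H.rank) = closure (A k) :=
    (closure_minimal (hH_subset _ _ (hA k)) isClosed_closure).antisymm
      (closure_minimal ((hx_dense k).trans (closure_mono (Set.range_subset_iff.2 h_mem)))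
        isClosed_closure)
  refine (hA k).congr fun i => ?_
  rw [← Metric.hausdorffEDist_closure_right, ← h_closure, Metric.hausdorffEDist_closure_right]

theorem theorem1p3 (D : ℕ) (hD : 1 ≤ D) (V : ℕ → Type*) [∀ i, Fintype (V i)] [∀ i, Nonempty (V i)]
    (G : ∀ i, SimpleGraph (V i)) (hconn : ∀ i, (G i).Connected)
    (hdeg : ∀ i x, ((G i).neighborSet x).encard ≤ D)
    (hconv : QuotientConvergent (fun i => (G i).toGraphing.rank)) :
    ∃ H : Graphing.{0}, (∀ x, (H.graph.neighborSet x).encard ≤ D) ∧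
      QuotientConvergesTo (fun i => (G i).toGraphing.rank) H.rank := by
  have (i : ℕ) : Countable (G i).toGraphing.Ω := inferInstanceAs (Countable (V i))
  exact theorem1p3_general hdeg hconv
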